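/- Let $K$ be a field of characteristic zero, $n\ge 0$, and let $P_{2n}=K[x_1,\dots,x_{2n}]$ carry the canonical Poisson bracket, the biderivation with $\{x_i,x_j\}=0=\{x_{n+i},x_{n+j}\}$ and $\{x_{n+i},x_j\}=\delta_{ij}$ for $1\le i,j\le n$. Let $A_{2n}$ be the Weyl algebra, generated by $x_1,\dots,x_{2n},\partial_1,\dots,\partial_{2n}$ with relations $[x_i,x_j]=[\partial_i,\partial_j]=0$, $[\partial_i,x_j]=\delta_{ij}$, acting on $P_{2n}$ in the usual way (multiplication by $x_i$, and $\partial_i=\partial/\partial x_i$). Let $\sigma$ be a Poisson endomorphism of $P_{2n}$, i.e. a $K$-algebra endomorphism with $\sigma(\{f,g\})=\{\sigma(f),\sigma(g)\}$ for all $f,g$, and let $d=\deg(\sigma)$ be the maximum of the total degrees of $\sigma(x_1),\dots,\sigma(x_{2n})$ (with $d=0$ if $n=0$, and $0^0=1$). Then $\sigma$ induces an algebra endomorphism of $A_{2n}$, again denoted $\sigma$, by $x_i\mapsto\sigma(x_i)$ for $1\le i\le 2n$, and $\partial_i\mapsto\{\sigma(x_{n+i}),\cdot\}$, $\partial_{n+i}\mapsto\{-\sigma(x_i),\cdot\}$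 for $1\le i\le n$, where the derivation $\{f,\cdot\}$ is viewed as the element $\sum_{j=1}^n\bigl(\frac{\partial f}{\partial x_{n+j}}\partial_j-\frac{\partial f}{\partial x_j}\partial_{n+j}\bigr)$ of $A_{2n}$. Let ${}^\sigma P_{2n}$ be the $A_{2n}$-module with underlying vector space $P_{2n}$ and action $a\cdot p:=\sigma(a)p$. Then: 1. The $A_{2n}$-module ${}^\sigma P_{2n}$ is holonomic (finitely generated, of Gelfand–Kirillov dimension $2n$); hence it has finite length and is cyclic (generated by one element). 2. The length of the $A_{2n}$-module ${}^\sigma P_{2n}$ is at most $d^{2n}$. -/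

import Mathlib

open MvPolynomial

noncomputable section

/-! ### Growth and Gelfand-Kirillov dimension -/

/-- The degree of growth `inf {r ∈ ℝ | f s ≤ s ^ r for all large s}` of `f : ℕ → ℕ`, with values in
`[-∞, ∞]`; it equals the limit superior of `log (f s) / log s`. -/
def growthDegree (f : ℕ → ℕ) : EReal :=
  ⨅ (r : ℝ) (_ : ∀ᶠ s : ℕ in Filter.atTop, (f s : ℝ) ≤ (s : ℝ) ^ r), (r : EReal)

/-- The Gelfand-Kirillov dimension of an `A`-module `M` over the field `K`: the supremum, over all
finite dimensional subspaces `V ∋ 1` of `A` and all finite dimensional subspaces `F` of `M`, of the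
degree of growth of `s ↦ dim (V ^ s F)`. -/
def gkDim (K A M : Type*) [Field K] [Ring A] [Algebra K A] [AddCommGroup M] [Module K M]
    [Module A M] [IsScalarTower K A M] : EReal :=
  ⨆ (V : Submodule K A) (_ : V.FG) (_ : (1 : A) ∈ V) (F : Submodule K M) (_ : F.FG),
    growthDegree fun s =>
      Module.finrank K (Submodule.map₂ (Algebra.lsmul K K M).toLinearMap (V ^ s) F)

/-! ### The Weyl algebra -/

/-- The defining relations of the Weyl algebra. In the free algebra, the generator `Sum.inl i` is
`xᵢ` and the generator `Sum.inr i` is `∂ᵢ`. -/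
inductive WeylAlgebra.Rel (K ι : Type*) [Field K] :
    FreeAlgebra K (ι ⊕ ι) → FreeAlgebra K (ι ⊕ ι) → Prop
  | x_comm (i j : ι) :
      Rel K ι (FreeAlgebra.ι K (Sum.inl i) * FreeAlgebra.ι K (Sum.inl j))
        (FreeAlgebra.ι K (Sum.inl j) * FreeAlgebra.ι K (Sum.inl i))
  | d_comm (i j : ι) :
      Rel K ι (FreeAlgebra.ι K (Sum.inr i) * FreeAlgebra.ι K (Sum.inr j))
        (FreeAlgebra.ι K (Sum.inr j) * FreeAlgebra.ι K (Sum.inr i))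
  | d_x_self (i : ι) :
      Rel K ι (FreeAlgebra.ι K (Sum.inr i) * FreeAlgebra.ι K (Sum.inl i))
        (FreeAlgebra.ι K (Sum.inl i) * FreeAlgebra.ι K (Sum.inr i) + 1)
  | d_x_ne (i j : ι) (h : i ≠ j) :
      Rel K ι (FreeAlgebra.ι K (Sum.inr i) * FreeAlgebra.ι K (Sum.inl j))
        (FreeAlgebra.ι K (Sum.inl j) * FreeAlgebra.ι K (Sum.inr i))

/-- The Weyl algebra over `K` in the variables `xᵢ, ∂ᵢ`, `i ∈ ι`. -/
def WeylAlgebra (K ι : Type*) [Field K] : Type _ := RingQuot (WeylAlgebra.Rel K ι)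

namespace WeylAlgebra

variable {K ι : Type*} [Field K]

instance : Ring (WeylAlgebra K ι) := inferInstanceAs (Ring (RingQuot (WeylAlgebra.Rel K ι)))

instance : Algebra K (WeylAlgebra K ι) :=
  inferInstanceAs (Algebra K (RingQuot (WeylAlgebra.Rel K ι)))

/-- The quotient map from the free algebra. -/
def mk : FreeAlgebra K (ι ⊕ ι) →ₐ[K] WeylAlgebra K ι := RingQuot.mkAlgHom K (WeylAlgebra.Rel K ι)

variable (K) in
/-- The generator `xᵢ`. -/
def x (i : ι) : WeylAlgebra K ι := mk (FreeAlgebra.ι K (Sum.inl i))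

variable (K) in
/-- The generator `∂ᵢ`. -/
def d (i : ι) : WeylAlgebra K ι := mk (FreeAlgebra.ι K (Sum.inr i))

theorem mk_rel {a b : FreeAlgebra K (ι ⊕ ι)} (h : Rel K ι a b) :
    (mk a : WeylAlgebra K ι) = mk b := RingQuot.mkAlgHom_rel K h

theorem x_mul_x (i j : ι) : x K i * x K j = x K j * x K i := by
  simpa only [map_mul, x, d] using mk_rel (Rel.x_comm (K := K) i j)

theorem d_mul_d (i j : ι) : d K i * d K j = d K j * d K i := by
  simpa only [map_mul, x, d] using mk_rel (Rel.d_comm (K := K) i j)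

theorem d_mul_x_self (i : ι) : d K i * x K i = x K i * d K i + 1 := by
  simpa only [map_mul, map_add, map_one, x, d] using mk_rel (Rel.d_x_self (K := K) i)

theorem d_mul_x_of_ne {i j : ι} (h : i ≠ j) : d K i * x K j = x K j * d K i := by
  simpa only [map_mul, x, d] using mk_rel (Rel.d_x_ne (K := K) i j h)

/-- The universal property of the Weyl algebra: elements `xᵢ', ∂ᵢ'` of an algebra `B` that satisfy
the defining relations determine an algebra homomorphism with `xᵢ ↦ xᵢ'`, `∂ᵢ ↦ ∂ᵢ'`. -/
def lift {B : Type*} [Ring B] [Algebra K B] (x' d' : ι → B)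
    (hx : ∀ i j, x' i * x' j = x' j * x' i) (hd : ∀ i j, d' i * d' j = d' j * d' i)
    (hs : ∀ i, d' i * x' i = x' i * d' i + 1) (hn : ∀ i j, i ≠ j → d' i * x' j = x' j * d' i) :
    WeylAlgebra K ι →ₐ[K] B :=
  RingQuot.liftAlgHom K (s := Rel K ι) ⟨FreeAlgebra.lift K (Sum.elim x' d'), by
    intro a b h
    induction h with
    | x_comm i j => simpa using hx i j
    | d_comm i j => simpa using hd i j
    | d_x_self i => simpa using hs i
    | d_x_ne i j h => simpa using hn i j h⟩

section lift

variable {B : Type*} [Ring B] [Algebra K B] (x' d' : ι → B)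
    (hx : ∀ i j, x' i * x' j = x' j * x' i) (hd : ∀ i j, d' i * d' j = d' j * d' i)
    (hs : ∀ i, d' i * x' i = x' i * d' i + 1) (hn : ∀ i j, i ≠ j → d' i * x' j = x' j * d' i)

theorem lift_x (i : ι) : lift x' d' hx hd hs hn (x K i) = x' i := by
  have h := RingQuot.liftAlgHom_mkAlgHom_apply (S := K) (s := Rel K ι)
    (FreeAlgebra.lift K (Sum.elim x' d'))
    (by
      intro a b h
      induction h with
      | x_comm i j => simpa using hx i j
      | d_comm i j => simpa using hd i j
      | d_x_self i => simpa using hs i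
      | d_x_ne i j h => simpa using hn i j h) (FreeAlgebra.ι K (Sum.inl i))
  rw [FreeAlgebra.lift_ι_apply] at h
  exact h

theorem lift_d (i : ι) : lift x' d' hx hd hs hn (d K i) = d' i := by
  have h := RingQuot.liftAlgHom_mkAlgHom_apply (S := K) (s := Rel K ι)
    (FreeAlgebra.lift K (Sum.elim x' d'))
    (by
      intro a b h
      induction h with
      | x_comm i j => simpa using hx i j
      | d_comm i j => simpa using hd i j
      | d_x_self i => simpa using hs i
      | d_x_ne i j h => simpa using hn i j h) (FreeAlgebra.ι K (Sum.inr i))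
  rw [FreeAlgebra.lift_ι_apply] at h
  exact h

end lift

theorem pderiv_comm (i j : ι) (p : MvPolynomial ι K) :
    pderiv i (pderiv j p) = pderiv j (pderiv i p) := by
  classical
  have h : ⁅pderiv (R := K) i, pderiv (R := K) j⁆ = 0 := by
    apply MvPolynomial.derivation_ext
    intro k
    rw [Derivation.commutator_apply, pderiv_X, pderiv_X]
    simp only [Pi.single_apply]
    split_ifs <;> simp
  have h2 := congrArg (fun D => D p) h
  simpa [Derivation.commutator_apply, sub_eq_zero] using h2

/-- The action of the Weyl algebra on polynomials: `xᵢ` acts as multiplication by `xᵢ` and `∂ᵢ` as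
the partial derivative `∂/∂xᵢ`. -/
def action (K ι : Type*) [Field K] : WeylAlgebra K ι →ₐ[K] Module.End K (MvPolynomial ι K) :=
  lift (fun i => LinearMap.mulLeft K (X i)) (fun i => (pderiv i).toLinearMap)
    (by
      intro i j
      apply LinearMap.ext
      intro p
      simp only [Module.End.mul_apply, LinearMap.mulLeft_apply]
      ring)
    (by
      intro i j
      apply LinearMap.ext
      intro p
      simpa using pderiv_comm i j p)
    (by
      intro i
      apply LinearMap.ext
      intro p
      simp [add_comm])
    (by
      intro i j h
      apply LinearMap.ext
      intro p
      simp [pderiv_X_of_ne h.symm])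

/-- Polynomials form a left module over the Weyl algebra. -/
instance : Module (WeylAlgebra K ι) (MvPolynomial ι K) :=
  Module.compHom (MvPolynomial ι K) (action K ι).toRingHom

theorem smul_def (a : WeylAlgebra K ι) (p : MvPolynomial ι K) : a • p = action K ι a p := rfl

instance : IsScalarTower K (WeylAlgebra K ι) (MvPolynomial ι K) where
  smul_assoc c a p := by simp [smul_def]

theorem x_smul (i : ι) (p : MvPolynomial ι K) : x K i • p = X i * p := by
  rw [smul_def, action, lift_x]; rfl

theorem d_smul (i : ι) (p : MvPolynomial ι K) : d K i • p = pderiv i p := by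
  rw [smul_def, action, lift_d]; rfl

/-- A module over the Weyl algebra in `m` pairs of variables is holonomic if it is finitely
generated and has Gelfand-Kirillov dimension `m`. -/
def IsHolonomic (K ι M : Type*) [Field K] [Fintype ι] [AddCommGroup M] [Module K M]
    [Module (WeylAlgebra K ι) M] [IsScalarTower K (WeylAlgebra K ι) M] : Prop :=
  Module.Finite (WeylAlgebra K ι) M ∧ gkDim K (WeylAlgebra K ι) M = (Fintype.card ι : EReal)

/-! ### Polynomials and vector fields inside the Weyl algebra -/

open scoped IsMulCommutative in
variable (K ι) in
/-- The inclusion of the polynomial algebra in the Weyl algebra, `X i ↦ xᵢ`. -/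
def ofPoly : MvPolynomial ι K →ₐ[K] WeylAlgebra K ι :=
  haveI : IsMulCommutative (Algebra.adjoin K (Set.range (x K (ι := ι)))) :=
    Algebra.isMulCommutative_adjoin K (by
      rintro _ ⟨i, rfl⟩ _ ⟨j, rfl⟩
      exact x_mul_x i j)
  (Algebra.adjoin K (Set.range (x K (ι := ι)))).val.comp
    (MvPolynomial.aeval (S₁ := Algebra.adjoin K (Set.range (x K (ι := ι)))) fun i => ⟨x K i, Algebra.subset_adjoin ⟨i, rfl⟩⟩)

theorem ofPoly_X (i : ι) : ofPoly K ι (X i) = x K i := by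
  simp [ofPoly]

theorem ofPoly_comm (p q : MvPolynomial ι K) :
    ofPoly K ι p * ofPoly K ι q = ofPoly K ι q * ofPoly K ι p := by
  rw [← map_mul, mul_comm, map_mul]

theorem d_mul_ofPoly (i : ι) (p : MvPolynomial ι K) :
    d K i * ofPoly K ι p = ofPoly K ι p * d K i + ofPoly K ι (pderiv i p) := by
  induction p using MvPolynomial.induction_on with
  | C a =>
    rw [pderiv_C, map_zero, add_zero, ← MvPolynomial.algebraMap_eq, AlgHom.commutes,
      Algebra.commutes]
  | add p q hp hq => simp only [map_add, mul_add, add_mul, hp, hq]; abel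
  | mul_X p j hp =>
    have hX : d K i * x K j = x K j * d K i + ofPoly K ι (pderiv i (X j)) := by
      by_cases h : i = j
      · subst h
        rw [pderiv_X_self, map_one, d_mul_x_self]
      · rw [pderiv_X_of_ne (Ne.symm h), map_zero, add_zero, d_mul_x_of_ne h]
    rw [pderiv_mul, map_mul, ← mul_assoc, hp, add_mul, mul_assoc, ofPoly_X, hX, map_add, map_mul,
      map_mul, ofPoly_X, mul_add, mul_assoc]
    abel

variable [Fintype ι]

/-- The vector field `∑ₐ uₐ ∂ₐ` as an element of the Weyl algebra. -/
def vectorField (u : ι → MvPolynomial ι K) : WeylAlgebra K ι := ∑ a, ofPoly K ι (u a) * d K a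

theorem vectorField_smul (u : ι → MvPolynomial ι K) (p : MvPolynomial ι K) :
    vectorField u * ofPoly K ι p =
      ofPoly K ι p * vectorField u + ofPoly K ι (∑ a, u a * pderiv a p) := by
  simp only [vectorField, Finset.sum_mul, Finset.mul_sum, map_sum, ← Finset.sum_add_distrib]
  refine Finset.sum_congr rfl fun a _ => ?_
  rw [mul_assoc, d_mul_ofPoly, mul_add, ← mul_assoc, ofPoly_comm, mul_assoc, map_mul]

theorem vectorField_mul (u w : ι → MvPolynomial ι K) :
    vectorField u * vectorField w =
      (∑ b, ∑ a, ofPoly K ι (w b * u a) * (d K a * d K b)) +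
        vectorField fun b => ∑ a, u a * pderiv a (w b) := by
  conv_lhs => rw [vectorField.eq_def w]
  rw [Finset.mul_sum, vectorField.eq_def (fun b => ∑ a, u a * pderiv a (w b)),
    ← Finset.sum_add_distrib]
  refine Finset.sum_congr rfl fun b _ => ?_
  rw [← mul_assoc, vectorField_smul, add_mul, vectorField, Finset.mul_sum, Finset.sum_mul]
  congr 1
  refine Finset.sum_congr rfl fun a _ => ?_
  rw [map_mul]
  simp only [mul_assoc]

theorem vectorField_commute (u w : ι → MvPolynomial ι K)
    (h : ∀ b, ∑ a, u a * pderiv a (w b) = ∑ a, w a * pderiv a (u b)) :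
    vectorField u * vectorField w = vectorField w * vectorField u := by
  rw [vectorField_mul, vectorField_mul, funext h, Finset.sum_comm]
  congr 1
  refine Finset.sum_congr rfl fun a _ => Finset.sum_congr rfl fun b _ => ?_
  rw [mul_comm, d_mul_d]

end WeylAlgebra

/-! ### Twisted modules -/

/-- The module `M` twisted by an endomorphism `φ` of `A`: the same vector space, on which `a` acts
as `φ a`. -/
def Twisted {K A : Type*} [Field K] [Ring A] [Algebra K A] (_φ : A →ₐ[K] A) (M : Type*) : Type _ :=
  M

namespace Twisted

variable {K A : Type*} [Field K] [Ring A] [Algebra K A] (φ : A →ₐ[K] A) (M : Type*)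
  [AddCommGroup M] [Module K M] [Module A M] [IsScalarTower K A M]

instance : AddCommGroup (Twisted φ M) := inferInstanceAs (AddCommGroup M)

instance : Module K (Twisted φ M) := inferInstanceAs (Module K M)

instance : Module A (Twisted φ M) := Module.compHom M φ.toRingHom

instance : IsScalarTower K A (Twisted φ M) where
  smul_assoc c a m := by
    have h (y : M) : φ (c • a) • y = c • (φ a • y) := by rw [map_smul, smul_assoc]
    exact h m

end Twisted

/-! ### The Poisson algebra of polynomials in `2n` variables -/

/-- The polynomial algebra in the `2n` variables `xᵢ = X (Sum.inl i)` and
`xₙ₊ᵢ = X (Sum.inr i)`, `i = 1, …, n`. -/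
abbrev PoissonPoly (K : Type*) [Field K] (n : ℕ) : Type _ := MvPolynomial (Fin n ⊕ Fin n) K

/-- The canonical Poisson bracket, with `{xₙ₊ᵢ, xⱼ} = δᵢⱼ` and `{xᵢ, xⱼ} = 0 = {xₙ₊ᵢ, xₙ₊ⱼ}`. -/
def poissonBracket {K : Type*} [Field K] {n : ℕ} (f g : PoissonPoly K n) : PoissonPoly K n :=
  ∑ i : Fin n, (pderiv (Sum.inr i) f * pderiv (Sum.inl i) g -
    pderiv (Sum.inl i) f * pderiv (Sum.inr i) g)

/-- The Poisson endomorphisms: the `K`-algebra endomorphisms that preserve the Poisson bracket. -/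
structure PoissonEnd (K : Type*) [Field K] (n : ℕ) extends
    PoissonPoly K n →ₐ[K] PoissonPoly K n where
  map_bracket (f g : PoissonPoly K n) :
    toAlgHom (poissonBracket f g) = poissonBracket (toAlgHom f) (toAlgHom g)

namespace PoissonEnd

variable {K : Type*} [Field K] {n : ℕ}

/-- The degree of an endomorphism: the largest total degree of the image of a variable. -/
def degree (σ : PoissonEnd K n) : ℕ :=
  Finset.univ.sup fun a : Fin n ⊕ Fin n => (σ.toAlgHom (X a)).totalDegree

/-- The components of the derivation `{f, ·}`. -/
def hamiltonianCoeff (f : PoissonPoly K n) : Fin n ⊕ Fin n → PoissonPoly K n :=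
  Sum.elim (fun i => pderiv (Sum.inr i) f) (fun i => -pderiv (Sum.inl i) f)

/-- The derivation `{f, ·}` of the polynomial algebra, as an element of the Weyl algebra. -/
def hamiltonian (f : PoissonPoly K n) : WeylAlgebra K (Fin n ⊕ Fin n) :=
  WeylAlgebra.vectorField (hamiltonianCoeff f)

theorem sum_hamiltonianCoeff (f p : PoissonPoly K n) :
    ∑ a, hamiltonianCoeff f a * pderiv a p = poissonBracket f p := by
  simp [hamiltonianCoeff, poissonBracket, Fintype.sum_sum_type, sub_eq_add_neg,
    Finset.sum_add_distrib]

theorem hamiltonian_smul (f p : PoissonPoly K n) : hamiltonian f • p = poissonBracket f p := by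
  have key (q p : PoissonPoly K n) : WeylAlgebra.ofPoly K _ q • p = q * p := by
    induction q using MvPolynomial.induction_on generalizing p with
    | C a =>
      rw [← MvPolynomial.algebraMap_eq, AlgHom.commutes, algebraMap_smul, Algebra.smul_def]
    | add q r hq hr => rw [map_add, add_smul, hq, hr, add_mul]
    | mul_X q i hq => rw [map_mul, mul_smul, WeylAlgebra.ofPoly_X, WeylAlgebra.x_smul, hq, mul_assoc]
  rw [← sum_hamiltonianCoeff, hamiltonian, WeylAlgebra.vectorField, Finset.sum_smul]
  refine Finset.sum_congr rfl fun a _ => ?_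
  rw [mul_smul, WeylAlgebra.d_smul, key]

theorem hamiltonian_mul_ofPoly (f p : PoissonPoly K n) :
    hamiltonian f * WeylAlgebra.ofPoly K _ p =
      WeylAlgebra.ofPoly K _ p * hamiltonian f + WeylAlgebra.ofPoly K _ (poissonBracket f p) := by
  rw [← sum_hamiltonianCoeff]
  exact WeylAlgebra.vectorField_smul _ _

theorem pderiv_bracket (a : Fin n ⊕ Fin n) (f g : PoissonPoly K n) :
    pderiv a (poissonBracket f g) =
      poissonBracket (pderiv a f) g + poissonBracket f (pderiv a g) := by
  simp only [poissonBracket, map_sum, map_sub, pderiv_mul, ← Finset.sum_add_distrib]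
  refine Finset.sum_congr rfl fun i _ => ?_
  rw [WeylAlgebra.pderiv_comm a (Sum.inr i) f, WeylAlgebra.pderiv_comm a (Sum.inr i) g,
    WeylAlgebra.pderiv_comm a (Sum.inl i) f, WeylAlgebra.pderiv_comm a (Sum.inl i) g]
  ring

theorem bracket_swap (f g : PoissonPoly K n) : poissonBracket f g = -poissonBracket g f := by
  simp only [poissonBracket, ← Finset.sum_neg_distrib]
  exact Finset.sum_congr rfl fun i _ => by ring

theorem bracket_neg_right (f g : PoissonPoly K n) :
    poissonBracket f (-g) = -poissonBracket f g := by
  simp only [poissonBracket, ← Finset.sum_neg_distrib, map_neg]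
  exact Finset.sum_congr rfl fun i _ => by ring

theorem bracket_neg_left (f g : PoissonPoly K n) :
    poissonBracket (-f) g = -poissonBracket f g := by
  rw [bracket_swap, bracket_neg_right, ← bracket_swap]

theorem hamiltonian_commute (f g : PoissonPoly K n)
    (h : ∀ a, pderiv a (poissonBracket f g) = 0) :
    hamiltonian f * hamiltonian g = hamiltonian g * hamiltonian f := by
  refine WeylAlgebra.vectorField_commute _ _ fun b => ?_
  rw [sum_hamiltonianCoeff, sum_hamiltonianCoeff]
  have h1 (a : Fin n ⊕ Fin n) :
      poissonBracket f (pderiv a g) = poissonBracket g (pderiv a f) := by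
    have h2 := h a
    rw [pderiv_bracket, bracket_swap (pderiv a f) g] at h2
    linear_combination h2
  cases b with
  | inl i => simpa [hamiltonianCoeff] using h1 (Sum.inr i)
  | inr i => simpa [hamiltonianCoeff, bracket_neg_right] using h1 (Sum.inl i)

/-- The Hamiltonian whose derivation is the partial derivative with respect to the given variable:
`∂ᵢ = {xₙ₊ᵢ, ·}` and `∂ₙ₊ᵢ = {-xᵢ, ·}` for `i = 1, …, n`. -/
def momentum (K : Type*) [Field K] {n : ℕ} : Fin n ⊕ Fin n → PoissonPoly K n :=
  Sum.elim (fun i => X (Sum.inr i)) (fun i => -X (Sum.inl i))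

theorem hamiltonianCoeff_momentum (a b : Fin n ⊕ Fin n) :
    hamiltonianCoeff (momentum K a) b = pderiv b (X a) := by
  classical
  rcases a with i | i <;> rcases b with j | j <;>
    simp [hamiltonianCoeff, momentum, pderiv_X, Pi.single_apply]

theorem momentum_bracket (a : Fin n ⊕ Fin n) (p : PoissonPoly K n) :
    poissonBracket (momentum K a) p = pderiv a p := by
  classical
  rw [← sum_hamiltonianCoeff]
  simp [hamiltonianCoeff_momentum, pderiv_X, Pi.single_apply]

theorem exists_momentum_bracket (a b : Fin n ⊕ Fin n) :
    ∃ c : K, poissonBracket (momentum K a) (momentum K b) = C c := by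
  classical
  rw [momentum_bracket]
  rcases b with j | j
  · exact ⟨if Sum.inr j = a then 1 else 0, by
      simp [momentum, pderiv_X, Pi.single_apply]⟩
  · exact ⟨if Sum.inl j = a then -1 else 0, by
      simp only [momentum, Sum.elim_inr, map_neg, pderiv_X, Pi.single_apply]
      split_ifs <;> simp⟩

theorem bracket_map_momentum_X (σ : PoissonEnd K n) (a b : Fin n ⊕ Fin n) :
    poissonBracket (σ.toAlgHom (momentum K a)) (σ.toAlgHom (X b)) =
      σ.toAlgHom (pderiv a (X b)) := by
  rw [← σ.map_bracket, momentum_bracket]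

/-- The endomorphism of the Weyl algebra in `2n` pairs of variables induced by a Poisson
endomorphism `σ`: `xₐ ↦ σ(xₐ)` for every `a`, `∂ᵢ ↦ {σ(xₙ₊ᵢ), ·}` and `∂ₙ₊ᵢ ↦ {-σ(xᵢ), ·}` for
`i = 1, …, n`. -/
def weylEnd (σ : PoissonEnd K n) :
    WeylAlgebra K (Fin n ⊕ Fin n) →ₐ[K] WeylAlgebra K (Fin n ⊕ Fin n) :=
  WeylAlgebra.lift
    (fun a => WeylAlgebra.ofPoly K _ (σ.toAlgHom (X a)))
    (Sum.elim (fun i => hamiltonian (σ.toAlgHom (X (Sum.inr i))))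
      (fun i => hamiltonian (-σ.toAlgHom (X (Sum.inl i)))))
    (fun a b => WeylAlgebra.ofPoly_comm _ _)
    (by
      have h (a b : Fin n ⊕ Fin n) := hamiltonian_commute (σ.toAlgHom (momentum K a))
        (σ.toAlgHom (momentum K b)) (fun e => by
          obtain ⟨c, hc⟩ := exists_momentum_bracket (K := K) a b
          rw [← σ.map_bracket, hc, ← MvPolynomial.algebraMap_eq, AlgHom.commutes,
            MvPolynomial.algebraMap_eq, pderiv_C])
      rintro (i | i) (j | j)
      · exact h (Sum.inl i) (Sum.inl j)
      · simpa [momentum] using h (Sum.inl i) (Sum.inr j)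
      · simpa [momentum] using h (Sum.inr i) (Sum.inl j)
      · simpa [momentum] using h (Sum.inr i) (Sum.inr j))
    (by
      intro a
      have h := hamiltonian_mul_ofPoly (σ.toAlgHom (momentum K a)) (σ.toAlgHom (X a))
      rw [bracket_map_momentum_X, pderiv_X_self, map_one, map_one] at h
      rcases a with i | i
      · exact h
      · simpa [momentum] using h)
    (by
      intro a b hab
      have h := hamiltonian_mul_ofPoly (σ.toAlgHom (momentum K a)) (σ.toAlgHom (X b))
      rw [bracket_map_momentum_X, pderiv_X_of_ne hab.symm, map_zero, map_zero, add_zero] at h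
      rcases a with i | i
      · exact h
      · simpa [momentum] using h)

theorem weylEnd_x (σ : PoissonEnd K n) (a : Fin n ⊕ Fin n) :
    σ.weylEnd (WeylAlgebra.x K a) = WeylAlgebra.ofPoly K _ (σ.toAlgHom (X a)) :=
  WeylAlgebra.lift_x _ _ _ _ _ _ a

theorem weylEnd_d (σ : PoissonEnd K n) (a : Fin n ⊕ Fin n) :
    σ.weylEnd (WeylAlgebra.d K a) =
      Sum.elim (fun i => hamiltonian (σ.toAlgHom (X (Sum.inr i))))
        (fun i => hamiltonian (-σ.toAlgHom (X (Sum.inl i)))) a :=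
  WeylAlgebra.lift_d _ _ _ _ _ _ a

/-- The module of polynomials in `2n` variables over the Weyl algebra, twisted by the endomorphism
of the Weyl algebra that `σ` induces. -/
abbrev TwistedPoly (σ : PoissonEnd K n) : Type _ := Twisted σ.weylEnd (PoissonPoly K n)

end PoissonEnd

end

noncomputable section

/-! Put m = 2n and filter the twisted module by F_k, the polynomials of degree at most d·k. Both
σ(x_a) and σ(∂_a) raise degrees by at most d, so F is compatible with the order filtration of the
Weyl algebra, and dim F_k = C(dk + m, m) ~ d^m k^m / m!.

This is played against a sharp Bernstein inequality, `exists_orbitMap_rename_injective`: for v ≠ 0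
in any module, some m of the 2m generators have normally ordered monomials that act independently on
v, so the operators of order at most s applied to v span at least C(s + m, m) ~ s^m / m! dimensions.
The leading constant matters: each strict step of a chain of submodules uses up s^m / m!, so a chain
has length at most d^m. The same two estimates give Gelfand–Kirillov dimension exactly m.

The inequality has two ingredients. Let g(s) be the dimension of the space of all a • v with a of
order at most s. Commutators with generators lower the order, so an operator of order s that kills
this space is zero; hence C(s + 2m, 2m) ≤ g(s) g(2s), and g cannot be O(s^(m-1)). Conversely, the
leading exponents of the symbols that annihilate v form a monomial ideal. Either some m variables
support none of them, which is the required independence, or every exponent outside the ideal has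
fewer than m large entries and g = O(s^(m-1)).

For cyclicity (m > 0), operators of order s have about s^(2m) dimensions and F only about s^m, so
every element has a nonzero annihilating operator; finite length then allows generators to be merged
one simple step at a time. -/

/-! ### Total degree and partial derivatives of polynomials. -/

theorem MvPolynomial.totalDegree_pderiv_le {R τ : Type*} [CommSemiring R] (i : τ)
    (p : MvPolynomial τ R) : (pderiv i p).totalDegree ≤ p.totalDegree - 1 := by
  classical
  refine Finset.sup_le fun e he => ?_
  have h : e + Finsupp.single i 1 ∈ p.support := by
    rw [mem_support_iff, coeff_pderiv] at he
    rw [mem_support_iff]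
    exact left_ne_zero_of_mul he
  have h1 := le_totalDegree h
  rw [Finsupp.sum_add_index' (fun _ => rfl) (fun _ _ _ => rfl), Finsupp.sum_single_index rfl] at h1
  omega

/-- Differentiation multiplies the coefficient at `e` by a positive exponent `e i`, which is nonzero
in characteristic zero. -/
theorem MvPolynomial.eq_C_of_pderiv_eq_zero {R τ : Type*} [CommRing R] [IsDomain R] [CharZero R]
    {p : MvPolynomial τ R} (h : ∀ i, pderiv i p = 0) : p = C (coeff 0 p) := by
  classical
  ext e
  rw [coeff_C]
  split_ifs with he
  · rw [he]
  · obtain ⟨i, hi⟩ := Finsupp.ne_iff.mp (Ne.symm he)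
    have h1 := coeff_pderiv (i := i) p (e - Finsupp.single i 1)
    have h2 : e - Finsupp.single i 1 + Finsupp.single i 1 = e :=
      tsub_add_cancel_of_le (Finsupp.single_le_iff.mpr (Nat.one_le_iff_ne_zero.mpr hi))
    rw [h, coeff_zero, h2] at h1
    exact (mul_eq_zero.mp h1.symm).resolve_right (Nat.cast_add_one_ne_zero _)

theorem MvPolynomial.totalDegree_X_mul_le {R τ : Type*} [CommSemiring R] (i : τ)
    (p : MvPolynomial τ R) : (X i * p).totalDegree ≤ p.totalDegree + 1 := by
  rcases subsingleton_or_nontrivial R with h | h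
  · rw [Subsingleton.elim (X i * p) 0, totalDegree_zero]
    exact Nat.zero_le _
  · have := totalDegree_mul (X i) p
    rw [totalDegree_X] at this
    omega

/-- A filtration of subspaces of the polynomial algebra that contains the constants and whose
degree goes up by one under multiplication by a variable contains the filtration by the total
degree. -/
theorem MvPolynomial.restrictTotalDegree_le_of_X_mul_mem {R τ : Type*} [CommSemiring R]
    (W : ℕ → Submodule R (MvPolynomial τ R)) (mono : Monotone W) (one : 1 ∈ W 0)
    (X_mul : ∀ i s, ∀ p ∈ W s, X i * p ∈ W (s + 1)) (s : ℕ) :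
    restrictTotalDegree τ R s ≤ W s := by
  have key (N : ℕ) (e : τ →₀ ℕ) (he : e.degree = N) : monomial e (1 : R) ∈ W N := by
    induction N generalizing e with
    | zero => rwa [(Finsupp.degree_eq_zero_iff e).mp he]
    | succ N ih =>
      obtain ⟨i, hi⟩ : ∃ i, e i ≠ 0 := by
        by_contra! h
        have h0 : e = 0 := Finsupp.ext h
        rw [h0, map_zero] at he
        omega
      have h2 : Finsupp.single i 1 + (e - Finsupp.single i 1) = e :=
        add_tsub_cancel_of_le (Finsupp.single_le_iff.mpr (Nat.one_le_iff_ne_zero.mpr hi))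
      rw [← h2, map_add, Finsupp.degree_single] at he
      rw [← h2, monomial_single_add, pow_one]
      exact X_mul i N _ (ih _ (by omega))
  intro p hp
  rw [p.as_sum]
  refine sum_mem fun e he => ?_
  rw [← mul_one (coeff e p), ← smul_eq_mul, ← smul_monomial]
  exact Submodule.smul_mem _ _ (mono ((le_totalDegree he).trans
    ((mem_restrictTotalDegree _ _ _).mp hp)) (key _ e rfl))

/-! ### Normal ordering: commutative symbols of differential operators. -/

namespace WeylAlgebra

variable {K ι : Type*} [Field K]

variable (K) in
/-- The commuting operators on the Weyl algebra of left multiplication by `xᵢ` and right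
multiplication by `∂ᵢ`. -/
def normalMul : ι ⊕ ι → Module.End K (WeylAlgebra K ι) :=
  Sum.elim (fun i => LinearMap.mulLeft K (x K i)) (fun i => LinearMap.mulRight K (d K i))

/-- Multiplying by `x` on the left and by `∂` on the right makes the mixed case mere associativity,
so commutative polynomials can act although `x` and `∂` do not commute. -/
theorem normalMul_comm (i j : ι ⊕ ι) :
    normalMul K i * normalMul K j = normalMul K j * normalMul K i := by
  apply LinearMap.ext
  intro a
  rcases i with i | i <;> rcases j with j | j <;>
    simp only [normalMul, Sum.elim_inl, Sum.elim_inr, Module.End.mul_apply,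
      LinearMap.mulLeft_apply, LinearMap.mulRight_apply]
  · rw [← mul_assoc, x_mul_x, mul_assoc]
  · rw [mul_assoc]
  · rw [mul_assoc]
  · rw [mul_assoc, d_mul_d, mul_assoc]

open scoped IsMulCommutative in
variable (K ι) in
/-- The algebra homomorphism `Xᵢ ↦ normalMul i`. -/
def normalAct : MvPolynomial (ι ⊕ ι) K →ₐ[K] Module.End K (WeylAlgebra K ι) :=
  haveI : IsMulCommutative (Algebra.adjoin K (Set.range (normalMul K (ι := ι)))) :=
    Algebra.isMulCommutative_adjoin K (by
      rintro _ ⟨i, rfl⟩ _ ⟨j, rfl⟩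
      exact normalMul_comm i j)
  (Algebra.adjoin K (Set.range (normalMul K (ι := ι)))).val.comp
    (MvPolynomial.aeval (S₁ := Algebra.adjoin K (Set.range (normalMul K (ι := ι))))
      fun i => ⟨normalMul K i, Algebra.subset_adjoin ⟨i, rfl⟩⟩)

theorem normalAct_X (i : ι ⊕ ι) : normalAct K ι (X i) = normalMul K i := by
  simp [normalAct]

variable (K ι) in
/-- Normal ordering: the linear map that sends the monomial with exponents `(α, β)` to
`x ^ α * ∂ ^ β`. -/
def normalOrder : MvPolynomial (ι ⊕ ι) K →ₗ[K] WeylAlgebra K ι :=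
  (LinearMap.applyₗ (1 : WeylAlgebra K ι)).comp (normalAct K ι).toLinearMap

theorem normalOrder_apply (p : MvPolynomial (ι ⊕ ι) K) :
    normalOrder K ι p = normalAct K ι p 1 := rfl

theorem normalOrder_C (c : K) : normalOrder K ι (C c) = algebraMap K _ c := by
  rw [normalOrder_apply, ← MvPolynomial.algebraMap_eq, AlgHom.commutes, Module.algebraMap_end_apply,
    Algebra.algebraMap_eq_smul_one]

theorem normalOrder_one : normalOrder K ι 1 = 1 := by
  rw [← C_1, normalOrder_C, map_one]

theorem normalOrder_X_inl_mul (i : ι) (p : MvPolynomial (ι ⊕ ι) K) :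
    normalOrder K ι (X (Sum.inl i) * p) = x K i * normalOrder K ι p := by
  rw [normalOrder_apply, map_mul, normalAct_X]
  rfl

theorem normalOrder_X_inr_mul (i : ι) (p : MvPolynomial (ι ⊕ ι) K) :
    normalOrder K ι (X (Sum.inr i) * p) = normalOrder K ι p * d K i := by
  rw [normalOrder_apply, map_mul, normalAct_X]
  rfl

/-- On symbols, the commutator with a generator is a formal partial derivative; here and in
`normalOrder_mul_x` it therefore lowers the order by one. -/
theorem d_mul_normalOrder (i : ι) (p : MvPolynomial (ι ⊕ ι) K) :
    d K i * normalOrder K ι p =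
      normalOrder K ι p * d K i + normalOrder K ι (pderiv (Sum.inl i) p) := by
  classical
  induction p using MvPolynomial.induction_on with
  | C a => rw [pderiv_C, map_zero, add_zero, normalOrder_C, Algebra.commutes]
  | add p q hp hq => simp only [map_add, mul_add, add_mul, hp, hq]; abel
  | mul_X p j hp =>
    rw [mul_comm p, pderiv_mul, map_add]
    rcases j with j | j
    · rw [normalOrder_X_inl_mul, normalOrder_X_inl_mul, mul_assoc, ← sub_eq_iff_eq_add.mpr hp,
        ← mul_assoc]
      by_cases h : i = j
      · subst h
        rw [pderiv_X_self, one_mul, d_mul_x_self]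
        noncomm_ring
      · rw [pderiv_X_of_ne (by simpa using Ne.symm h), zero_mul, map_zero, d_mul_x_of_ne h]
        noncomm_ring
    · rw [pderiv_X_of_ne (by simp), zero_mul, map_zero, zero_add, normalOrder_X_inr_mul,
        normalOrder_X_inr_mul, ← mul_assoc, hp, add_mul]
      simp only [mul_assoc, d_mul_d i j]

theorem normalOrder_mul_x (i : ι) (p : MvPolynomial (ι ⊕ ι) K) :
    normalOrder K ι p * x K i =
      x K i * normalOrder K ι p + normalOrder K ι (pderiv (Sum.inr i) p) := by
  classical
  induction p using MvPolynomial.induction_on with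
  | C a => rw [pderiv_C, map_zero, add_zero, normalOrder_C, Algebra.commutes]
  | add p q hp hq => simp only [map_add, mul_add, add_mul, hp, hq]; abel
  | mul_X p j hp =>
    rw [mul_comm p, pderiv_mul, map_add]
    rcases j with j | j
    · rw [pderiv_X_of_ne (by simp), zero_mul, map_zero, zero_add, normalOrder_X_inl_mul,
        normalOrder_X_inl_mul, mul_assoc, hp, mul_add, ← mul_assoc, ← mul_assoc, x_mul_x]
    · rw [normalOrder_X_inr_mul, normalOrder_X_inr_mul, ← mul_assoc, ← sub_eq_iff_eq_add'.mpr hp,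
        mul_assoc]
      by_cases h : i = j
      · subst h
        rw [pderiv_X_self, one_mul, d_mul_x_self]
        noncomm_ring
      · rw [pderiv_X_of_ne (by simpa using Ne.symm h), zero_mul, map_zero,
          d_mul_x_of_ne (Ne.symm h)]
        noncomm_ring

theorem d_mul_normalOrder' (i : ι) (p : MvPolynomial (ι ⊕ ι) K) :
    d K i * normalOrder K ι p =
      normalOrder K ι (X (Sum.inr i) * p + pderiv (Sum.inl i) p) := by
  rw [d_mul_normalOrder, map_add, normalOrder_X_inr_mul]

/-- The Weyl algebra is generated by the `xᵢ` and the `∂ᵢ`. -/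
theorem induction {P : WeylAlgebra K ι → Prop} (algebraMap : ∀ c : K, P (algebraMap K _ c))
    (x : ∀ i, P (x K i)) (d : ∀ i, P (d K i)) (add : ∀ a b, P a → P b → P (a + b))
    (mul : ∀ a b, P a → P b → P (a * b)) (a : WeylAlgebra K ι) : P a := by
  obtain ⟨a, rfl⟩ : ∃ b, mk b = a := RingQuot.mkAlgHom_surjective K (Rel K ι) a
  induction a using FreeAlgebra.induction with
  | grade0 c => rw [AlgHom.commutes]; exact algebraMap c
  | grade1 i =>
    rcases i with i | i
    · exact x i
    · exact d i
  | mul a b ha hb => rw [map_mul]; exact mul _ _ ha hb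
  | add a b ha hb => rw [map_add]; exact add _ _ ha hb

/-! ### Faithfulness of operators of bounded order on an orbit. -/

section Module

variable {M : Type*} [AddCommGroup M] [Module K M] [Module (WeylAlgebra K ι) M]
  [IsScalarTower K (WeylAlgebra K ι) M]

/-- An operator of order at most `s` that annihilates all `a • v` with `a` of order at most `s`
is zero, or `v` is zero. -/
theorem eq_zero_of_normalOrder_smul_eq_zero [CharZero K] {v : M} (hv : v ≠ 0) {s : ℕ}
    {p : MvPolynomial (ι ⊕ ι) K} (hp : p.totalDegree ≤ s)
    (h : ∀ p' : MvPolynomial (ι ⊕ ι) K, p'.totalDegree ≤ s →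
      normalOrder K ι p • normalOrder K ι p' • v = 0) : p = 0 := by
  have const (p : MvPolynomial (ι ⊕ ι) K) (c : K) (hc : p = C c)
      (h : normalOrder K ι p • normalOrder K ι 1 • v = 0) : p = 0 := by
    rw [normalOrder_one, one_smul, hc, normalOrder_C, algebraMap_smul] at h
    rw [hc, (smul_eq_zero.mp h).resolve_right hv, C_0]
  induction s generalizing p with
  | zero =>
    exact const p _ (totalDegree_eq_zero_iff_eq_C.mp (Nat.le_zero.mp hp)) (h 1 (by simp))
  | succ s ih =>
    -- A derivative of `p` is, up to sign, the symbol of the commutator with a generator. Moving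
    -- that generator onto `p'` costs one order there, which the passage from `s` to `s + 1` allows.
    refine const p _ (eq_C_of_pderiv_eq_zero fun j => ?_) (h 1 (by simp))
    refine ih ((totalDegree_pderiv_le j p).trans (by omega)) fun p' hp' => ?_
    rcases j with i | i
    · rw [eq_sub_iff_add_eq'.mpr (d_mul_normalOrder i p).symm, sub_smul, mul_smul, mul_smul,
        h p' (hp'.trans (Nat.le_succ s)), smul_zero, zero_sub, neg_eq_zero,
        ← mul_smul (d K i), d_mul_normalOrder']
      refine h _ ((totalDegree_add _ _).trans (max_le ?_ ?_))
      · exact (totalDegree_X_mul_le _ _).trans (by omega)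
      · exact (totalDegree_pderiv_le _ _).trans (by omega)
    · rw [eq_sub_iff_add_eq'.mpr (normalOrder_mul_x i p).symm, sub_smul, mul_smul, mul_smul,
        h p' (hp'.trans (Nat.le_succ s)), smul_zero, sub_zero, ← mul_smul (x K i),
        ← normalOrder_X_inl_mul]
      exact h _ ((totalDegree_X_mul_le _ _).trans (by omega))

end Module

/-! ### Filtered modules. -/

/-- The filtrations of a module that are compatible with the filtration of the Weyl algebra by the
order in the generators `xᵢ` and `∂ᵢ`. -/
structure BernsteinFiltration (K ι M : Type*) [Field K] [AddCommGroup M] [Module K M]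
    [Module (WeylAlgebra K ι) M] where
  /-- The subspaces. -/
  space : ℕ → Submodule K M
  mono : Monotone space
  x_smul_mem (i : ι) (k : ℕ) (v : M) : v ∈ space k → x K i • v ∈ space (k + 1)
  d_smul_mem (i : ι) (k : ℕ) (v : M) : v ∈ space k → d K i • v ∈ space (k + 1)

namespace BernsteinFiltration

variable {M : Type*} [AddCommGroup M] [Module K M] [Module (WeylAlgebra K ι) M]
  [IsScalarTower K (WeylAlgebra K ι) M] (F : BernsteinFiltration K ι M)

theorem normalOrder_smul_mem {s k : ℕ} {p : MvPolynomial (ι ⊕ ι) K} (hp : p.totalDegree ≤ s)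
    {v : M} (hv : v ∈ F.space k) : normalOrder K ι p • v ∈ F.space (k + s) := by
  -- The level `k` is quantified inside `W` because `∂` enters on the right: it acts on `v` first
  -- and shifts `k`.
  let W (s : ℕ) : Submodule K (MvPolynomial (ι ⊕ ι) K) :=
    { carrier := {p | ∀ k, ∀ v ∈ F.space k, normalOrder K ι p • v ∈ F.space (k + s)}
      zero_mem' := fun k v _ => by simp
      add_mem' := fun {p p'} hp hp' k v hv => by
        rw [map_add, add_smul]
        exact add_mem (hp k v hv) (hp' k v hv)
      smul_mem' := fun c p hp k v hv => by
        rw [map_smul, smul_assoc]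
        exact Submodule.smul_mem _ _ (hp k v hv) }
  have h := restrictTotalDegree_le_of_X_mul_mem W
    (fun s t hst p hp k v hv => F.mono (by omega) (hp k v hv))
    (fun k v hv => by rwa [normalOrder_one, one_smul])
    (fun i s p hp k v hv => by
      rcases i with i | i
      · rw [normalOrder_X_inl_mul, mul_smul]
        exact F.x_smul_mem i _ _ (hp k v hv)
      · rw [normalOrder_X_inr_mul, mul_smul]
        have := hp (k + 1) _ (F.d_smul_mem i k v hv)
        rwa [add_assoc, add_comm 1 s] at this) s
  exact h ((mem_restrictTotalDegree _ _ _).mpr hp) k v hv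

theorem exists_smul_mem (a : WeylAlgebra K ι) :
    ∃ r, ∀ k, ∀ v ∈ F.space k, a • v ∈ F.space (k + r) := by
  induction a using WeylAlgebra.induction with
  | algebraMap c =>
    refine ⟨0, fun k v hv => ?_⟩
    rw [algebraMap_smul]
    exact Submodule.smul_mem _ _ hv
  | x i => exact ⟨1, F.x_smul_mem i⟩
  | d i => exact ⟨1, F.d_smul_mem i⟩
  | add a b ha hb =>
    obtain ⟨r, hr⟩ := ha
    obtain ⟨t, ht⟩ := hb
    refine ⟨r + t, fun k v hv => ?_⟩
    rw [add_smul]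
    exact add_mem (F.mono (by omega) (hr k v hv)) (F.mono (by omega) (ht k v hv))
  | mul a b ha hb =>
    obtain ⟨r, hr⟩ := ha
    obtain ⟨t, ht⟩ := hb
    refine ⟨t + r, fun k v hv => ?_⟩
    rw [mul_smul, ← add_assoc]
    exact hr _ _ (ht k v hv)

end BernsteinFiltration

end WeylAlgebra
-- Counting exponents.
theorem MvPolynomial.finrank_restrictTotalDegree (K τ : Type*) [Field K] [Fintype τ] (s : ℕ) :
    Module.finrank K (restrictTotalDegree τ K s) =
      (s + Fintype.card τ).choose (Fintype.card τ) := by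
  classical
  have h : {e : τ →₀ ℕ | (e.sum fun _ k => k) ≤ s} =
      ((Finset.range (s + 1)).biUnion fun i => Finset.univ.finsuppAntidiag i :
        Finset (τ →₀ ℕ)) := by
    ext e
    simp [Finsupp.sum_fintype]
  rw [restrictTotalDegree, h, Module.finrank_eq_nat_card_basis (basisRestrictSupport K _),
    Nat.card_coe_set_eq, Set.ncard_coe_finset, Finset.card_biUnion]
  · simp only [Finset.card_finsuppAntidiag_nat_eq_multichoose, Nat.sum_range_multichoose,
      Finset.card_univ]
  · intro i _ j _ hij
    rw [Function.onFun, Finset.disjoint_left]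
    intro e hi hj
    rw [Finset.mem_finsuppAntidiag] at hi hj
    exact hij (hi.1.symm.trans hj.1)

/-- The exponents of degree at most `s` with fewer than `m` entries from `t` on are at most a
constant times `(s + 1) ^ (m - 1)` in number. -/
theorem Finsupp.exists_finset_card_large_lt (τ : Type*) [Fintype τ] [DecidableEq τ] (m t : ℕ) :
    ∃ c : ℕ, ∀ s : ℕ, ∃ B : Finset (τ →₀ ℕ),
      (∀ e : τ →₀ ℕ, e.degree ≤ s → (Finset.univ.filter fun j => t ≤ e j).card < m → e ∈ B) ∧
        (s + 1) * B.card ≤ c * (s + 1) ^ m := by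
  -- `T` is the set of coordinates that may be large: at most `s` on `T` and below `t` off `T`. The
  -- factor `s + 1` on the left of the bound replaces the exponent `m - 1`, which would truncate at
  -- `m = 0`.
  let 𝒯 : Finset (Finset τ) := Finset.univ.filter fun T => T.card < m
  refine ⟨∑ T ∈ 𝒯, t ^ Tᶜ.card, fun s => ⟨𝒯.biUnion fun T => (Fintype.piFinset fun j =>
    if j ∈ T then Finset.range (s + 1) else Finset.range t).image Finsupp.equivFunOnFinite.symm,
    fun e he hm => ?_, ?_⟩⟩
  · refine Finset.mem_biUnion.mpr ⟨_, Finset.mem_filter.mpr ⟨Finset.mem_univ _, hm⟩,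
      Finset.mem_image.mpr ⟨e, Fintype.mem_piFinset.mpr fun j => ?_, by simp⟩⟩
    split_ifs with h
    · exact Finset.mem_range.mpr (Nat.lt_succ_of_le ((Finsupp.le_degree j e).trans he))
    · simpa using h
  · calc (s + 1) * (𝒯.biUnion _).card
        ≤ (s + 1) * ∑ T ∈ 𝒯, (s + 1) ^ T.card * t ^ Tᶜ.card := by
          refine Nat.mul_le_mul_left _ (Finset.card_biUnion_le.trans (Finset.sum_le_sum
            fun T _ => Finset.card_image_le.trans ?_))
          rw [Fintype.card_piFinset, ← Finset.prod_mul_prod_compl T]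
          refine Nat.mul_le_mul (le_of_eq ?_) (le_of_eq ?_)
          · rw [Finset.prod_congr rfl fun j hj => by rw [if_pos hj], Finset.prod_const,
              Finset.card_range]
          · rw [Finset.prod_congr rfl fun j hj => by rw [if_neg (Finset.mem_compl.mp hj)],
              Finset.prod_const, Finset.card_range]
      _ ≤ (∑ T ∈ 𝒯, t ^ Tᶜ.card) * (s + 1) ^ m := by
          rw [Finset.mul_sum, Finset.sum_mul]
          refine Finset.sum_le_sum fun T hT => ?_
          rw [← mul_assoc, ← pow_succ', mul_comm]
          exact Nat.mul_le_mul_left _ (Nat.pow_le_pow_right (Nat.succ_pos s)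
            (Finset.mem_filter.mp hT).2)

/-! ### Leading exponents and the growth dichotomy. -/

namespace MvPolynomial

open scoped MonomialOrder

section LeadingExponents

variable {K τ V : Type*} [Field K] [LinearOrder τ] [WellFoundedGT τ] [AddCommGroup V] [Module K V]
  (f : MvPolynomial τ K →ₗ[K] V)

/-- The exponents of the leading monomials of the nonzero elements of the kernel of `f`, with
respect to the degree lexicographic order. -/
def leadingExponents : Set (τ →₀ ℕ) :=
  {e | ∃ p, f p = 0 ∧ p ≠ 0 ∧ MonomialOrder.degLex.degree p = e}

variable {f}

/-- The order compares total degrees first, so the correction `r` cannot disturb the leading term of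
`X j * p`. Stability up to lower degree is all that kernels of orbit maps provide, since they are
not ideals of the polynomial ring. -/
theorem add_mem_leadingExponents (hf : ∀ j p, f p = 0 →
    ∃ r : MvPolynomial τ K, r.totalDegree ≤ p.totalDegree ∧ f (X j * p + r) = 0)
    {e : τ →₀ ℕ} (he : e ∈ leadingExponents f) (g : τ →₀ ℕ) : e + g ∈ leadingExponents f := by
  have single {e : τ →₀ ℕ} (he : e ∈ leadingExponents f) (j : τ) :
      e + Finsupp.single j 1 ∈ leadingExponents f := by
    obtain ⟨p, hp, hp0, rfl⟩ := he
    obtain ⟨r, hr, hpr⟩ := hf j p hp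
    have h1 : MonomialOrder.degLex.degree (X j * p) =
        MonomialOrder.degLex.degree p + Finsupp.single j 1 := by
      rw [MonomialOrder.degree_mul (X_ne_zero j) hp0, MonomialOrder.degree_X, add_comm]
    have h2 : MonomialOrder.degLex.degree r ≺[MonomialOrder.degLex]
        MonomialOrder.degLex.degree (X j * p) := by
      rw [MonomialOrder.degLex_lt_iff, Finsupp.DegLex.lt_iff]
      left
      rw [ofDegLex_toDegLex, ofDegLex_toDegLex, h1, map_add, degree_degLexDegree,
        degree_degLexDegree, Finsupp.degree_single]
      omega
    have h3 := MonomialOrder.degree_add_of_lt h2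
    refine ⟨_, hpr, fun h0 => ?_, h3.trans h1⟩
    rw [h0, MonomialOrder.degree_zero, h1] at h3
    simpa using congrArg (fun e => e j) h3
  induction g using Finsupp.induction_linear generalizing e with
  | zero => rwa [add_zero]
  | add g g' hg hg' => rw [← add_assoc]; exact hg' (hg he)
  | single j k =>
    induction k with
    | zero => rwa [Finsupp.single_zero, add_zero]
    | succ k ih => rw [Finsupp.single_add, ← add_assoc]; exact single ih j

/-- Division with remainder: a kernel element rewrites its leading monomial, modulo the kernel, in
smaller monomials. The order is well founded and refines the degree, so the bound `s` survives. -/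
theorem map_restrictTotalDegree_le_span (s : ℕ) :
    (restrictTotalDegree τ K s).map f ≤ Submodule.span K
      ((fun e => f (monomial e 1)) '' {e | e ∉ leadingExponents f ∧ e.degree ≤ s}) := by
  set W := Submodule.span K
    ((fun e => f (monomial e 1)) '' {e | e ∉ leadingExponents f ∧ e.degree ≤ s})
  have key (e : DegLex (τ →₀ ℕ)) (he : (ofDegLex e).degree ≤ s) :
      f (monomial (ofDegLex e) 1) ∈ W := by
    induction e using WellFoundedLT.induction with
    | ind e ih =>
      by_cases hl : ofDegLex e ∈ leadingExponents f
      · obtain ⟨p, hp, hp0, hpe⟩ := hl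
        have hmem : ofDegLex e ∈ p.support := hpe ▸ MonomialOrder.degree_mem_support hp0
        have h := congrArg f p.as_sum
        rw [hp, map_sum, ← Finset.add_sum_erase _ _ hmem, eq_comm, add_eq_zero_iff_eq_neg] at h
        have hc (e : τ →₀ ℕ) : f (monomial e (coeff e p)) = coeff e p • f (monomial e 1) := by
          rw [← map_smul, smul_monomial, smul_eq_mul, mul_one]
        rw [hc] at h
        refine (Submodule.smul_mem_iff _ (mem_support_iff.mp hmem)).mp (h ▸ neg_mem (sum_mem ?_))
        intro e' he'
        rw [hc]
        have hlt : toDegLex e' < e := by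
          refine lt_of_le_of_ne ?_ fun h => (Finset.mem_erase.mp he').1 (by rw [← h]; rfl)
          have := MonomialOrder.degLex.le_degree (Finset.mem_erase.mp he').2
          rwa [hpe] at this
        exact Submodule.smul_mem _ _ (ih _ hlt ((Finsupp.DegLex.monotone_degree hlt.le).trans he))
      · exact Submodule.subset_span ⟨_, ⟨hl, he⟩, rfl⟩
  rw [Submodule.map_le_iff_le_comap]
  intro p hp
  rw [p.as_sum]
  refine sum_mem fun e he => ?_
  rw [← mul_one (coeff e p), ← smul_eq_mul, ← smul_monomial]
  exact Submodule.smul_mem _ _ (key (toDegLex e)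
    ((le_totalDegree he).trans ((mem_restrictTotalDegree _ _ _).mp hp)))

end LeadingExponents

/-- If the kernel of `f` is stable under multiplication by variables up to terms of lower degree,
then `f` is injective on a polynomial subalgebra in `m` of the variables, or the images of the
spaces of polynomials of degree at most `s` grow at most like `s ^ (m - 1)`. -/
theorem exists_injective_or_finrank_map_le {K τ V : Type*} [Field K] [Fintype τ] [AddCommGroup V]
    [Module K V] (f : MvPolynomial τ K →ₗ[K] V) (hf : ∀ j p, f p = 0 →
      ∃ r : MvPolynomial τ K, r.totalDegree ≤ p.totalDegree ∧ f (X j * p + r) = 0) (m : ℕ) :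
    (∃ S : Finset τ, S.card = m ∧
      ∀ p : MvPolynomial S K, f (rename Subtype.val p) = 0 → p = 0) ∨
    ∃ c : ℕ, ∀ s : ℕ, (s + 1) * Module.finrank K ((restrictTotalDegree τ K s).map f) ≤
      c * (s + 1) ^ m := by
  classical
  let _ : LinearOrder τ := LinearOrder.lift' (Fintype.equivFin τ) (Fintype.equivFin τ).injective
  -- If no leading exponent is supported in `S`, a nonzero polynomial in the variables of `S` cannot
  -- lie in the kernel, as its own leading exponent is supported in `S`.
  by_cases h : ∃ S : Finset τ, S.card = m ∧ ∀ e ∈ leadingExponents f, ¬ e.support ⊆ S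
  · left
    obtain ⟨S, hS, h⟩ := h
    refine ⟨S, hS, fun p hp => ?_⟩
    by_contra hp0
    have hr : rename (Subtype.val : S → τ) p ≠ 0 := by
      rwa [Ne, map_eq_zero_iff _ (rename_injective _ Subtype.val_injective)]
    refine h _ ⟨_, hp, hr, rfl⟩ fun j hj => ?_
    have h1 := MonomialOrder.degree_mem_support (m := MonomialOrder.degLex) hr
    have h2 := vars_rename (Subtype.val : S → τ) p ((mem_vars_iff_mem_support j).mpr ⟨_, h1, hj⟩)
    obtain ⟨i, -, rfl⟩ := Finset.mem_image.mp h2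
    exact i.2
  · right
    push Not at h
    choose! e he hes using h
    obtain ⟨t, ht⟩ : ∃ t, ∀ S : Finset τ, ∀ j, e S j ≤ t :=
      ⟨Finset.univ.sup fun S => Finset.univ.sup fun j => e S j, fun S j =>
        (Finset.le_sup (f := fun j => e S j) (Finset.mem_univ j)).trans
          (Finset.le_sup (f := fun S => Finset.univ.sup fun j => e S j) (Finset.mem_univ S))⟩
    obtain ⟨c, hc⟩ := Finsupp.exists_finset_card_large_lt τ m t
    refine ⟨c, fun s => ?_⟩
    obtain ⟨B, hB, hcard⟩ := hc s
    refine le_trans (Nat.mul_le_mul_left _ ?_) hcard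
    have h1 : (restrictTotalDegree τ K s).map f ≤
        Submodule.span K (B.image fun e => f (monomial e 1) : Finset V) := by
      refine (map_restrictTotalDegree_le_span s).trans (Submodule.span_mono ?_)
      rintro _ ⟨e', ⟨he', hs⟩, rfl⟩
      rw [Finset.coe_image]
      refine ⟨e', hB e' hs ?_, rfl⟩
      -- With `m` entries at least `t`, `e'` dominates the leading exponent chosen for these
      -- coordinates, hence is itself leading.
      by_contra! hm
      obtain ⟨S, hS, hSm⟩ := Finset.exists_subset_card_eq hm
      have hle : e S ≤ e' := fun j => by
        by_cases hj : j ∈ S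
        · exact (ht S j).trans (Finset.mem_filter.mp (hS hj)).2
        · rw [Finsupp.notMem_support_iff.mp fun h => hj (hes S hSm h)]
          exact Nat.zero_le _
      apply he'
      rw [← add_tsub_cancel_of_le hle]
      exact add_mem_leadingExponents hf (he S hSm) _
    exact (Submodule.finrank_mono h1).trans ((finrank_span_finset_le_card _).trans
      Finset.card_image_le)

end MvPolynomial
-- Bernstein's inequality.
theorem Nat.succ_pow_le_factorial_mul_choose (s k : ℕ) :
    (s + 1) ^ k ≤ k.factorial * (s + k).choose k := by
  rw [← Nat.ascFactorial_eq_factorial_mul_choose]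
  exact Nat.pow_succ_le_ascFactorial (s + 1) k

theorem Nat.factorial_mul_choose_le_pow (s k : ℕ) :
    k.factorial * (s + k).choose k ≤ (s + k) ^ k := by
  rw [← Nat.ascFactorial_eq_factorial_mul_choose]
  exact Nat.ascFactorial_le_pow_add s k

namespace WeylAlgebra

variable {K ι M : Type*} [Field K] [AddCommGroup M] [Module K M] [Module (WeylAlgebra K ι) M]
  [IsScalarTower K (WeylAlgebra K ι) M]

variable (K ι) in
/-- The linear map `p ↦ normalOrder p • v`. -/
def orbitMap (v : M) : MvPolynomial (ι ⊕ ι) K →ₗ[K] M :=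
  (LinearMap.toSpanSingleton (WeylAlgebra K ι) M v).restrictScalars K ∘ₗ normalOrder K ι

theorem orbitMap_apply (v : M) (p : MvPolynomial (ι ⊕ ι) K) :
    orbitMap K ι v p = normalOrder K ι p • v := rfl

theorem x_smul_orbitMap (v : M) (i : ι) (p : MvPolynomial (ι ⊕ ι) K) :
    x K i • orbitMap K ι v p = orbitMap K ι v (X (Sum.inl i) * p) := by
  rw [orbitMap_apply, orbitMap_apply, normalOrder_X_inl_mul, mul_smul]

theorem d_smul_orbitMap (v : M) (i : ι) (p : MvPolynomial (ι ⊕ ι) K) :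
    d K i • orbitMap K ι v p =
      orbitMap K ι v (X (Sum.inr i) * p + pderiv (Sum.inl i) p) := by
  rw [orbitMap_apply, orbitMap_apply, ← d_mul_normalOrder', mul_smul]

variable (K ι) in
/-- The filtration of a module by the subspaces of all `a • v` with `a` of order at most `s`. -/
def BernsteinFiltration.generatedBy (v : M) : BernsteinFiltration K ι M where
  space s := (restrictTotalDegree (ι ⊕ ι) K s).map (orbitMap K ι v)
  mono s t hst := Submodule.map_mono fun p hp =>
    (mem_restrictTotalDegree _ _ _).mpr (((mem_restrictTotalDegree _ _ _).mp hp).trans hst)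
  x_smul_mem i k w hw := by
    obtain ⟨p, hp, rfl⟩ := hw
    have := (mem_restrictTotalDegree _ _ _).mp hp
    exact ⟨X (Sum.inl i) * p,
      (mem_restrictTotalDegree _ _ _).mpr ((totalDegree_X_mul_le _ _).trans (by omega)),
      (x_smul_orbitMap v i p).symm⟩
  d_smul_mem i k w hw := by
    obtain ⟨p, hp, rfl⟩ := hw
    have := (mem_restrictTotalDegree _ _ _).mp hp
    refine ⟨X (Sum.inr i) * p + pderiv (Sum.inl i) p, add_mem ?_ ?_, (d_smul_orbitMap v i p).symm⟩
    · exact (mem_restrictTotalDegree _ _ _).mpr ((totalDegree_X_mul_le _ _).trans (by omega))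
    · exact (mem_restrictTotalDegree _ _ _).mpr ((totalDegree_pderiv_le _ _).trans (by omega))

variable [CharZero K] [Fintype ι]

/-- The dimension count behind Bernstein's inequality. -/
theorem choose_le_finrank_mul_finrank {v : M} (hv : v ≠ 0) (s : ℕ) :
    (s + 2 * Fintype.card ι).choose (2 * Fintype.card ι) ≤
      Module.finrank K ((restrictTotalDegree (ι ⊕ ι) K s).map (orbitMap K ι v)) *
      Module.finrank K ((restrictTotalDegree (ι ⊕ ι) K (s + s)).map (orbitMap K ι v)) := by
  let F := BernsteinFiltration.generatedBy K ι v
  let Φ : restrictTotalDegree (ι ⊕ ι) K s →ₗ[K] F.space s →ₗ[K] F.space (s + s) :=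
    { toFun := fun p => (Algebra.lsmul K K M (normalOrder K ι p)).restrict fun w hw =>
        F.normalOrder_smul_mem ((mem_restrictTotalDegree _ _ _).mp p.2) hw
      map_add' := fun p p' => by
        ext w
        change normalOrder K ι (p + p' : MvPolynomial (ι ⊕ ι) K) • (w : M) =
          normalOrder K ι p • (w : M) + normalOrder K ι p' • (w : M)
        rw [map_add, add_smul]
      map_smul' := fun c p => by
        ext w
        change normalOrder K ι (c • p : MvPolynomial (ι ⊕ ι) K) • (w : M) =
          c • normalOrder K ι p • (w : M)
        rw [map_smul, smul_assoc] }
  have hΦ : Function.Injective Φ := by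
    rw [injective_iff_map_eq_zero]
    intro p hp
    refine Subtype.ext (eq_zero_of_normalOrder_smul_eq_zero hv
      ((mem_restrictTotalDegree _ _ _).mp p.2) fun p' hp' => ?_)
    exact congrArg Subtype.val (LinearMap.congr_fun hp
      ⟨_, p', (mem_restrictTotalDegree _ _ _).mpr hp', rfl⟩)
  have : Module.Finite K (F.space s) := Module.Finite.map _ _
  have : Module.Finite K (F.space (s + s)) := Module.Finite.map _ _
  have h := LinearMap.finrank_le_finrank_of_injective hΦ
  rwa [Module.finrank_linearMap, finrank_restrictTotalDegree, Fintype.card_sum, ← two_mul] at h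

/-- The sharp form of Bernstein's inequality: for every nonzero element `v` of a module over the
Weyl algebra, there are as many as `card ι` of the generators of the Weyl algebra such that the
normally ordered monomials in these generators, applied to `v`, are linearly independent. -/
theorem exists_orbitMap_rename_injective {v : M} (hv : v ≠ 0) :
    ∃ S : Finset (ι ⊕ ι), S.card = Fintype.card ι ∧
      ∀ p : MvPolynomial S K, orbitMap K ι v (rename Subtype.val p) = 0 → p = 0 := by
  refine (exists_injective_or_finrank_map_le (orbitMap K ι v) ?_ (Fintype.card ι)).resolve_right ?_
  · rintro (i | i) p hp
    · refine ⟨0, by simp, ?_⟩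
      rw [add_zero, ← x_smul_orbitMap, hp, smul_zero]
    · refine ⟨pderiv (Sum.inl i) p, (totalDegree_pderiv_le _ _).trans (Nat.sub_le _ _), ?_⟩
      rw [← d_smul_orbitMap, hp, smul_zero]
  · rintro ⟨c, hc⟩
    set m := Fintype.card ι
    -- If the growth were of order `m - 1`, the product of the dimensions at `s` and `2 * s` would
    -- have order `2 * m - 2`, against the lower bound of order `2 * m`.
    have key (s : ℕ) : (s + 1) * (2 * s + 1) ≤ (2 * m).factorial * (c * c * 2 ^ m) := by
      have h1 := hc s
      have h2 := hc (s + s)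
      have h3 := choose_le_finrank_mul_finrank (K := K) (ι := ι) hv s
      have h4 := Nat.succ_pow_le_factorial_mul_choose s (2 * m)
      set g := Module.finrank K ((restrictTotalDegree (ι ⊕ ι) K s).map (orbitMap K ι v))
      set g' := Module.finrank K ((restrictTotalDegree (ι ⊕ ι) K (s + s)).map (orbitMap K ι v))
      refine Nat.le_of_mul_le_mul_right (c := (s + 1) ^ (2 * m)) ?_ (by positivity)
      calc (s + 1) * (2 * s + 1) * (s + 1) ^ (2 * m)
          ≤ (s + 1) * (2 * s + 1) * ((2 * m).factorial * (g * g')) := by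
            gcongr
            exact h4.trans (by gcongr)
        _ = (2 * m).factorial * (((s + 1) * g) * ((s + s + 1) * g')) := by ring
        _ ≤ (2 * m).factorial * ((c * (s + 1) ^ m) * (c * (s + s + 1) ^ m)) := by gcongr
        _ ≤ (2 * m).factorial * ((c * (s + 1) ^ m) * (c * (2 * (s + 1)) ^ m)) := by
          gcongr
          omega
        _ = (2 * m).factorial * (c * c * 2 ^ m) * (s + 1) ^ (2 * m) := by
          rw [mul_pow, two_mul m, pow_add]; ring
    generalize (2 * m).factorial * (c * c * 2 ^ m) = N at key
    nlinarith [key N]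

end WeylAlgebra
-- Asymptotics and degrees of growth.
-- Divide by `(s + 1) ^ m` and let `s` tend to infinity: shifts of the filtration disappear and only
-- leading coefficients remain.
theorem le_pow_of_forall_mul_pow_le {l d c m : ℕ}
    (h : ∀ s : ℕ, l * (s + 1) ^ m ≤ (d * (s + 1) + c) ^ m) : l ≤ d ^ m := by
  have h1 : Filter.Tendsto (fun s : ℕ => ((d : ℝ) + c * (1 / ((s : ℝ) + 1))) ^ m) Filter.atTop
      (nhds (((d : ℝ) + c * 0) ^ m)) :=
    (tendsto_const_nhds.add (tendsto_one_div_add_atTop_nhds_zero_nat.const_mul _)).pow m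
  have h2 : (l : ℝ) ≤ ((d : ℝ) + c * 0) ^ m := by
    refine ge_of_tendsto' h1 fun s => ?_
    have hs : (0 : ℝ) < (s : ℝ) + 1 := by positivity
    have h3 : (l : ℝ) * ((s : ℝ) + 1) ^ m ≤ (d * ((s : ℝ) + 1) + c) ^ m := by exact_mod_cast h s
    rw [show (d : ℝ) + c * (1 / ((s : ℝ) + 1)) = (d * ((s : ℝ) + 1) + c) / ((s : ℝ) + 1) by
      field_simp, div_pow, le_div_iff₀ (by positivity)]
    exact h3
  rw [mul_zero, add_zero] at h2
  exact_mod_cast h2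

/-- For every real `r > m` the constant `c` is eventually absorbed by `s ^ (r - m)`. -/
theorem growthDegree_le {f : ℕ → ℕ} {c m : ℕ} (h : ∀ s : ℕ, 1 ≤ s → f s ≤ c * s ^ m) :
    growthDegree f ≤ (m : EReal) := by
  rw [← EReal.coe_natCast, ← EReal.le_of_forall_lt_iff_le]
  intro r hr
  have hr' : (m : ℝ) < r := by exact_mod_cast hr
  refine iInf₂_le r ?_
  have h1 := (tendsto_rpow_atTop (sub_pos.mpr hr')).comp tendsto_natCast_atTop_atTop
  filter_upwards [h1.eventually_ge_atTop (c : ℝ), Filter.eventually_ge_atTop 1] with s hs hs1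
  have hs0 : (0 : ℝ) < s := by exact_mod_cast hs1
  calc (f s : ℝ) ≤ c * (s : ℝ) ^ m := by exact_mod_cast h s hs1
    _ ≤ (s : ℝ) ^ (r - m) * (s : ℝ) ^ m := by gcongr; exact hs
    _ = (s : ℝ) ^ r := by rw [← Real.rpow_natCast, ← Real.rpow_add hs0, sub_add_cancel]

theorem le_growthDegree {f : ℕ → ℕ} {c m : ℕ} (h : ∀ s : ℕ, s ^ m ≤ c * f s) :
    (m : EReal) ≤ growthDegree f := by
  refine le_iInf₂ fun r hr => ?_
  rw [← EReal.coe_natCast, EReal.coe_le_coe_iff]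
  by_contra! hlt
  have h1 := (tendsto_rpow_atTop (sub_pos.mpr hlt)).comp tendsto_natCast_atTop_atTop
  obtain ⟨s, hs, hsr, hs1⟩ := ((h1.eventually_gt_atTop (c : ℝ)).and
    (hr.and (Filter.eventually_ge_atTop 1))).exists
  have hs0 : (0 : ℝ) < s := by exact_mod_cast hs1
  have h2 : (s : ℝ) ^ ((m : ℝ) - r) * (s : ℝ) ^ r ≤ c * (s : ℝ) ^ r := by
    rw [← Real.rpow_add hs0, sub_add_cancel, Real.rpow_natCast]
    calc (s : ℝ) ^ m ≤ c * (f s : ℝ) := by exact_mod_cast h s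
      _ ≤ c * (s : ℝ) ^ r := by gcongr
  exact absurd (le_of_mul_le_mul_right h2 (Real.rpow_pos_of_pos hs0 r)) (not_le.mpr hs)

/-! ### Gelfand–Kirillov dimension, length and torsion. -/

namespace WeylAlgebra

variable {K ι M : Type*} [Field K] [AddCommGroup M] [Module K M] [Module (WeylAlgebra K ι) M]
  [IsScalarTower K (WeylAlgebra K ι) M]

theorem orbitMap_mem_submodule (N : Submodule (WeylAlgebra K ι) M) {v : M} (hv : v ∈ N)
    (p : MvPolynomial (ι ⊕ ι) K) : orbitMap K ι v p ∈ N := N.smul_mem _ hv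

/-- The order filtration of the Weyl algebra is contained in the filtration by the powers of a
subspace that contains the generators. -/
theorem normalOrder_mem_pow {V : Submodule K (WeylAlgebra K ι)} (one : 1 ∈ V)
    (hx : ∀ i, x K i ∈ V) (hd : ∀ i, d K i ∈ V) {s : ℕ} {p : MvPolynomial (ι ⊕ ι) K}
    (hp : p.totalDegree ≤ s) : normalOrder K ι p ∈ V ^ s := by
  refine restrictTotalDegree_le_of_X_mul_mem (fun s => (V ^ s).comap (normalOrder K ι))
    ?_ ?_ ?_ s ((mem_restrictTotalDegree _ _ _).mpr hp)
  · exact fun s t hst => Submodule.comap_mono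
      (pow_le_pow_right' (Submodule.one_le.mpr one) hst)
  · rw [Submodule.mem_comap, normalOrder_one, pow_zero]
    exact Submodule.one_le.mp le_rfl
  · rintro (i | i) s p hp
    · rw [Submodule.mem_comap, normalOrder_X_inl_mul, pow_succ']
      exact Submodule.mul_mem_mul (hx i) hp
    · rw [Submodule.mem_comap, normalOrder_X_inr_mul, pow_succ]
      exact Submodule.mul_mem_mul hp (hd i)

/-- The sharp Bernstein inequality, tested on the span of 1 and the generators and on a single line
in `M`. -/
theorem card_le_gkDim [Fintype ι] [CharZero K] [Nontrivial M] :
    (Fintype.card ι : EReal) ≤ gkDim K (WeylAlgebra K ι) M := by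
  obtain ⟨v, hv⟩ := exists_ne (0 : M)
  obtain ⟨S, hS, hinj⟩ := exists_orbitMap_rename_injective (K := K) (ι := ι) hv
  let V : Submodule K (WeylAlgebra K ι) :=
    Submodule.span K (insert 1 (Set.range (x K) ∪ Set.range (d K)))
  have hV : V.FG := Submodule.fg_span
    (((Set.finite_range _).union (Set.finite_range _)).insert _)
  have h1 : 1 ∈ V := Submodule.subset_span (Set.mem_insert _ _)
  have hx (i : ι) : x K i ∈ V := Submodule.subset_span (.inr (.inl ⟨i, rfl⟩))
  have hd (i : ι) : d K i ∈ V := Submodule.subset_span (.inr (.inr ⟨i, rfl⟩))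
  refine le_trans ?_ (le_iSup₂_of_le V hV (le_iSup₂_of_le h1 (Submodule.span K {v})
    (le_iSup_of_le (Submodule.fg_span_singleton v) le_rfl)))
  refine le_growthDegree (c := (Fintype.card ι).factorial) fun s => ?_
  let W := Submodule.map₂ (Algebra.lsmul K K M).toLinearMap (V ^ s) (Submodule.span K {v})
  have hW : W.FG := (hV.pow s).map₂ _ (Submodule.fg_span_singleton v)
  have : Module.Finite K W := Module.Finite.iff_fg.mpr hW
  let Φ : restrictTotalDegree S K s →ₗ[K] W :=
    ((orbitMap K ι v ∘ₗ (rename Subtype.val).toLinearMap) ∘ₗ Submodule.subtype _).codRestrict W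
      fun p => Submodule.apply_mem_map₂ _ (normalOrder_mem_pow h1 hx hd
        ((totalDegree_rename_le _ _).trans ((mem_restrictTotalDegree _ _ _).mp p.2)))
        (Submodule.mem_span_singleton_self v)
  have hΦ : Function.Injective Φ := by
    rw [injective_iff_map_eq_zero]
    exact fun p hp => Subtype.ext (hinj p (congrArg Subtype.val hp))
  have h2 := LinearMap.finrank_le_finrank_of_injective hΦ
  rw [finrank_restrictTotalDegree, Fintype.card_coe, hS] at h2
  calc s ^ Fintype.card ι ≤ (s + 1) ^ Fintype.card ι := Nat.pow_le_pow_left (Nat.le_succ s) _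
    _ ≤ _ := Nat.succ_pow_le_factorial_mul_choose s _
    _ ≤ _ := Nat.mul_le_mul_left _ h2

namespace BernsteinFiltration

variable (F : BernsteinFiltration K ι M) (exhaustive : ∀ v, ∃ k, v ∈ F.space k)
  (finite : ∀ k, Module.Finite K (F.space k))

include exhaustive in
-- Finitely many operators have a common order bound `r`, so products of `s` of them raise the
-- filtration by at most `r * s`.
theorem exists_map₂_pow_le {V : Submodule K (WeylAlgebra K ι)} (hV : V.FG) {E : Submodule K M}
    (hE : E.FG) : ∃ k r, ∀ s, Submodule.map₂ (Algebra.lsmul K K M).toLinearMap (V ^ s) E ≤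
      F.space (k + r * s) := by
  obtain ⟨T, rfl⟩ := hV
  obtain ⟨B, rfl⟩ := hE
  choose r hr using F.exists_smul_mem
  choose k hk using exhaustive
  refine ⟨B.sup k, T.sup r, fun s => ?_⟩
  have hT (a : WeylAlgebra K ι) (ha : a ∈ Submodule.span K (T : Set (WeylAlgebra K ι))) (j : ℕ)
      (v : M) (hv : v ∈ F.space j) : a • v ∈ F.space (j + T.sup r) := by
    induction ha using Submodule.span_induction with
    | mem a ha => exact F.mono (Nat.add_le_add_left (Finset.le_sup ha) j) (hr a j v hv)
    | zero => rw [zero_smul]; exact zero_mem _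
    | add a b _ _ ha hb => rw [add_smul]; exact add_mem ha hb
    | smul c a _ ha => rw [smul_assoc]; exact Submodule.smul_mem _ _ ha
  have hpow (s : ℕ) (a : WeylAlgebra K ι)
      (ha : a ∈ Submodule.span K (T : Set (WeylAlgebra K ι)) ^ s) (j : ℕ) (v : M)
      (hv : v ∈ F.space j) : a • v ∈ F.space (j + T.sup r * s) := by
    induction s generalizing a with
    | zero =>
      rw [pow_zero] at ha
      obtain ⟨c, rfl⟩ := Submodule.mem_one.mp ha
      rw [algebraMap_smul]
      exact Submodule.smul_mem _ _ hv
    | succ s ih =>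
      rw [pow_succ'] at ha
      induction ha using Submodule.mul_induction_on' with
      | mem_mul_mem a ha b hb =>
        rw [mul_smul, mul_add, mul_one, ← add_assoc]
        exact hT a ha _ _ (ih b hb)
      | add a _ b _ ha hb => rw [add_smul]; exact add_mem ha hb
  refine Submodule.map₂_le.mpr fun a ha v hv => hpow s a ha _ v ?_
  refine Submodule.span_le.mpr ?_ hv
  exact fun b hb => F.mono (Finset.le_sup hb) (hk b)

variable [Fintype ι]

include exhaustive finite in
-- Apply the sharp Bernstein inequality to a nonzero class of `N'` modulo `N`: the resulting
-- elements of `N'` are independent modulo `N`, so their span adds its full dimension to that of the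
-- part of `N`.
theorem exists_finrank_inf_add_le [CharZero K] {N N' : Submodule (WeylAlgebra K ι) M}
    (hN : N < N') : ∃ k₀, ∀ k, k₀ ≤ k → ∀ s,
      Module.finrank K (N.restrictScalars K ⊓ F.space (k + s) : Submodule K M) +
        (s + Fintype.card ι).choose (Fintype.card ι) ≤
      Module.finrank K (N'.restrictScalars K ⊓ F.space (k + s) : Submodule K M) := by
  obtain ⟨v, hv', hv⟩ := Set.exists_of_ssubset hN
  obtain ⟨k₀, hk₀⟩ := exhaustive v
  refine ⟨k₀, fun k hk s => ?_⟩
  have hv0 : N.mkQ v ≠ 0 := by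
    rwa [Submodule.mkQ_apply, Ne, Submodule.Quotient.mk_eq_zero]
  obtain ⟨S, hS, hinj⟩ := exists_orbitMap_rename_injective (K := K) (ι := ι) hv0
  let U : Submodule K M := N.restrictScalars K ⊓ F.space (k + s)
  let W : Submodule K M := N'.restrictScalars K ⊓ F.space (k + s)
  have := finite (k + s)
  have : Module.Finite K W := Submodule.finiteDimensional_of_le (inf_le_right :
    W ≤ F.space (k + s))
  have : Module.Finite K U := Submodule.finiteDimensional_of_le (inf_le_right :
    U ≤ F.space (k + s))
  let Φ : restrictTotalDegree S K s →ₗ[K] W :=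
    ((orbitMap K ι v ∘ₗ (rename Subtype.val).toLinearMap) ∘ₗ Submodule.subtype _).codRestrict W
      fun p => ⟨orbitMap_mem_submodule N' hv' _, F.normalOrder_smul_mem
        ((totalDegree_rename_le _ _).trans ((mem_restrictTotalDegree _ _ _).mp p.2))
        (F.mono hk hk₀)⟩
  have hUW : U ≤ W := inf_le_inf_right _ hN.le
  let Ψ : U × restrictTotalDegree S K s →ₗ[K] W := (Submodule.inclusion hUW).coprod Φ
  have hΨ : Function.Injective Ψ := by
    rw [injective_iff_map_eq_zero]
    rintro ⟨u, p⟩ hup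
    have h1 : (u : M) + orbitMap K ι v (rename Subtype.val (p : MvPolynomial S K)) = 0 :=
      congrArg Subtype.val hup
    have hp : (p : MvPolynomial S K) = 0 := by
      refine hinj _ ?_
      rw [orbitMap_apply, ← map_smul, ← orbitMap_apply, Submodule.mkQ_apply,
        Submodule.Quotient.mk_eq_zero, ← neg_eq_of_add_eq_zero_right h1]
      exact neg_mem u.2.1
    rw [hp, map_zero, map_zero, add_zero] at h1
    exact Prod.ext (Subtype.ext h1) (Subtype.ext hp)
  have h2 := LinearMap.finrank_le_finrank_of_injective hΨ
  rwa [Module.finrank_prod, finrank_restrictTotalDegree, Fintype.card_coe, hS] at h2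

include exhaustive finite in
theorem exists_length_mul_choose_le [CharZero K]
    (p : LTSeries (Submodule (WeylAlgebra K ι) M)) : ∃ k, ∀ s,
      p.length * (s + Fintype.card ι).choose (Fintype.card ι) ≤
        Module.finrank K (F.space (k + s)) := by
  -- Allowing every `k ≥ k₀` lets the thresholds of successive steps be replaced by their maximum.
  have key (i : ℕ) (hi : i ≤ p.length) : ∃ k₀, ∀ k, k₀ ≤ k → ∀ s,
      i * (s + Fintype.card ι).choose (Fintype.card ι) ≤ Module.finrank K
        ((p ⟨i, Nat.lt_succ_of_le hi⟩).restrictScalars K ⊓ F.space (k + s) : Submodule K M) := by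
    induction i with
    | zero => exact ⟨0, fun k _ s => by simp⟩
    | succ i ih =>
      obtain ⟨k₀, h₀⟩ := ih (by omega)
      obtain ⟨k₁, h₁⟩ := F.exists_finrank_inf_add_le exhaustive finite (p.step ⟨i, by omega⟩)
      refine ⟨max k₀ k₁, fun k hk s => ?_⟩
      rw [add_mul, one_mul]
      exact (Nat.add_le_add_right (h₀ k ((le_max_left _ _).trans hk) s) _).trans
        (h₁ k ((le_max_right _ _).trans hk) s)
  obtain ⟨k, hk⟩ := key p.length le_rfl
  have := finite
  exact ⟨k, fun s => (hk k le_rfl s).trans (Submodule.finrank_mono inf_le_right)⟩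

variable {d : ℕ} (dim_le : ∀ s, Module.finrank K (F.space s) ≤
  (d * s + Fintype.card ι).choose (Fintype.card ι))

include exhaustive finite dim_le in
theorem length_le [CharZero K] :
    Module.length (WeylAlgebra K ι) M ≤ ((d ^ Fintype.card ι : ℕ) : ℕ∞) := by
  rw [← WithBot.coe_le_coe, Module.coe_length, Order.krullDim, iSup_le_iff]
  intro p
  have hp : p.length ≤ d ^ Fintype.card ι := by
    obtain ⟨k, hk⟩ := F.exists_length_mul_choose_le exhaustive finite p
    refine le_pow_of_forall_mul_pow_le (c := d * k + Fintype.card ι) fun s => ?_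
    set m := Fintype.card ι
    calc p.length * (s + 1) ^ m
        ≤ p.length * (m.factorial * (s + m).choose m) :=
          Nat.mul_le_mul_left _ (Nat.succ_pow_le_factorial_mul_choose s m)
      _ = m.factorial * (p.length * (s + m).choose m) := by ring
      _ ≤ m.factorial * (d * (k + s) + m).choose m :=
          Nat.mul_le_mul_left _ ((hk s).trans (dim_le _))
      _ ≤ (d * (k + s) + m) ^ m := Nat.factorial_mul_choose_le_pow _ _
      _ ≤ (d * (s + 1) + (d * k + m)) ^ m := Nat.pow_le_pow_left (by nlinarith) _
  exact_mod_cast hp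

include exhaustive finite dim_le in
theorem gkDim_le : gkDim K (WeylAlgebra K ι) M ≤ (Fintype.card ι : EReal) := by
  refine iSup₂_le fun V hV => iSup₂_le fun _ E => iSup_le fun hE => ?_
  obtain ⟨k, r, h⟩ := F.exists_map₂_pow_le exhaustive hV hE
  set m := Fintype.card ι
  refine growthDegree_le (c := (d * k + d * r + m) ^ m) fun s hs => ?_
  have := finite
  calc _ ≤ (d * (k + r * s) + m).choose m := (Submodule.finrank_mono (h s)).trans (dim_le _)
    _ ≤ m.factorial * (d * (k + r * s) + m).choose m :=
        Nat.le_mul_of_pos_left _ (Nat.factorial_pos m)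
    _ ≤ (d * (k + r * s) + m) ^ m := Nat.factorial_mul_choose_le_pow _ _
    _ ≤ ((d * k + d * r + m) * s) ^ m := by
      refine Nat.pow_le_pow_left ?_ _
      have h1 := Nat.mul_le_mul_left (d * k) hs
      have h2 := Nat.mul_le_mul_left m hs
      linarith
    _ = _ := mul_pow _ _ _

include exhaustive finite dim_le in
-- An injective orbit map would embed a space of growth order `2 * m` in one of order `m`. This
-- needs `m > 0`: with no variables both orders are zero and the claim fails for `u ≠ 0`.
theorem exists_ne_zero_orbitMap_eq_zero [Nonempty ι] (u : M) :
    ∃ p : MvPolynomial (ι ⊕ ι) K, p ≠ 0 ∧ orbitMap K ι u p = 0 := by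
  by_contra! hinj
  obtain ⟨k, hk⟩ := exhaustive u
  have hm : 0 < Fintype.card ι := Fintype.card_pos
  set m := Fintype.card ι
  have key (s : ℕ) : (s + 1) ^ m ≤ (2 * m).factorial * (d * k + d + m) ^ m := by
    let Φ : restrictTotalDegree (ι ⊕ ι) K s →ₗ[K] F.space (k + s) :=
      (orbitMap K ι u ∘ₗ Submodule.subtype _).codRestrict _ fun p =>
        F.normalOrder_smul_mem ((mem_restrictTotalDegree _ _ _).mp p.2) hk
    have hΦ : Function.Injective Φ := by
      rw [injective_iff_map_eq_zero]
      intro p hp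
      by_contra hp0
      exact hinj p (fun h => hp0 (Subtype.ext h)) (congrArg Subtype.val hp)
    have := finite
    have h1 := (LinearMap.finrank_le_finrank_of_injective hΦ).trans (dim_le _)
    rw [finrank_restrictTotalDegree, Fintype.card_sum, ← two_mul] at h1
    refine Nat.le_of_mul_le_mul_right (c := (s + 1) ^ m) ?_ (by positivity)
    calc (s + 1) ^ m * (s + 1) ^ m = (s + 1) ^ (2 * m) := by rw [two_mul, pow_add]
      _ ≤ (2 * m).factorial * (s + 2 * m).choose (2 * m) :=
          Nat.succ_pow_le_factorial_mul_choose _ _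
      _ ≤ (2 * m).factorial * (m.factorial * (d * (k + s) + m).choose m) :=
          Nat.mul_le_mul_left _ (h1.trans (Nat.le_mul_of_pos_left _ (Nat.factorial_pos m)))
      _ ≤ (2 * m).factorial * (d * (k + s) + m) ^ m :=
          Nat.mul_le_mul_left _ (Nat.factorial_mul_choose_le_pow _ _)
      _ ≤ (2 * m).factorial * ((d * k + d + m) * (s + 1)) ^ m := by
          refine Nat.mul_le_mul_left _ (Nat.pow_le_pow_left ?_ _)
          have : 0 ≤ d * k * s + m * s := Nat.zero_le _
          linarith
      _ = _ := by rw [mul_pow, mul_assoc]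
  have h1 := key ((2 * m).factorial * (d * k + d + m) ^ m)
  have h2 := Nat.le_self_pow hm.ne' ((2 * m).factorial * (d * k + d + m) ^ m + 1)
  omega

end BernsteinFiltration

/-! ### Cyclicity of torsion modules of finite length. -/

/-- An artinian module over the Weyl algebra is cyclic if it is noetherian and every element is
annihilated by a nonzero operator. -/
theorem exists_span_singleton_eq_top [CharZero K] [IsNoetherian (WeylAlgebra K ι) M]
    [IsArtinian (WeylAlgebra K ι) M]
    (torsion : ∀ u : M, ∃ p : MvPolynomial (ι ⊕ ι) K, p ≠ 0 ∧ orbitMap K ι u p = 0) :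
    ∃ v : M, Submodule.span (WeylAlgebra K ι) {v} = ⊤ := by
  -- Generating modulo `N` permits induction from larger `N` to smaller: a generator modulo a cover
  -- `N'` of `N` is corrected to one modulo `N`.
  suffices h : ∀ N : Submodule (WeylAlgebra K ι) M,
      ∃ u, Submodule.span (WeylAlgebra K ι) {u} ⊔ N = ⊤ by
    simpa using h ⊥
  intro N
  induction N using WellFoundedGT.induction with
  | ind N ih =>
    rcases eq_or_ne N ⊤ with rfl | hN
    · exact ⟨0, sup_top_eq _⟩
    obtain ⟨N', hNN', -⟩ := exists_covBy_le_of_lt hN.lt_top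
    obtain ⟨u, hu⟩ := ih N' hNN'.lt
    obtain ⟨v, hv', hv⟩ := Set.exists_of_ssubset hNN'.lt
    obtain ⟨p, hp0, hpu⟩ := torsion u
    have hv0 : N.mkQ v ≠ 0 := by
      rwa [Submodule.mkQ_apply, Ne, Submodule.Quotient.mk_eq_zero]
    obtain ⟨p', hp'⟩ : ∃ p' : MvPolynomial (ι ⊕ ι) K,
        normalOrder K ι p • normalOrder K ι p' • v ∉ N := by
      by_contra! h
      refine hp0 (eq_zero_of_normalOrder_smul_eq_zero (K := K) hv0 le_rfl fun p' _ => ?_)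
      rw [← map_smul, ← map_smul, Submodule.mkQ_apply, Submodule.Quotient.mk_eq_zero]
      exact h p'
    set b := normalOrder K ι p'
    -- Since `p` kills `u`, applying it to `u + b • v` leaves `p • b • v`, which lies in `N'` but
    -- not in `N`. As `N'` covers `N`, the new span plus `N` contains `N'`, hence `b • v`, hence
    -- `u`.
    refine ⟨u + b • v, ?_⟩
    set Q := Submodule.span (WeylAlgebra K ι) {u + b • v} ⊔ N
    have hw : u + b • v ∈ Q :=
      Submodule.mem_sup_left (Submodule.mem_span_singleton_self _)
    have h1 : normalOrder K ι p • b • v ∈ Q := by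
      have := Q.smul_mem (normalOrder K ι p) hw
      rwa [smul_add, ← orbitMap_apply, hpu, zero_add] at this
    have h2 : N' ≤ Q := by
      have h3 : N < N' ⊓ Q := lt_of_le_of_ne (le_inf hNN'.le le_sup_right) fun h =>
        hp' (h ▸ ⟨N'.smul_mem _ (N'.smul_mem _ hv'), h1⟩)
      rcases hNN'.eq_or_eq h3.le inf_le_left with h | h
      · exact absurd h h3.ne'
      · exact inf_eq_left.mp h
    have h3 : u ∈ Q := by
      have := sub_mem hw (h2 (N'.smul_mem b hv'))
      rwa [add_sub_cancel_right] at this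
    rw [eq_top_iff, ← hu]
    exact sup_le ((Submodule.span_singleton_le_iff_mem _ _).mpr h3) h2

end WeylAlgebra

/-! ### The degree filtration of the twisted module. -/

namespace PoissonEnd

variable {K : Type*} [Field K] {n : ℕ}

theorem totalDegree_poissonBracket_le (f g : PoissonPoly K n) :
    (poissonBracket f g).totalDegree ≤ f.totalDegree + g.totalDegree := by
  have h (a b : Fin n ⊕ Fin n) :
      (pderiv a f * pderiv b g).totalDegree ≤ f.totalDegree + g.totalDegree :=
    (totalDegree_mul _ _).trans (add_le_add
      ((totalDegree_pderiv_le a f).trans (Nat.sub_le _ _))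
      ((totalDegree_pderiv_le b g).trans (Nat.sub_le _ _)))
  exact totalDegree_finsetSum_le fun i _ => (totalDegree_sub _ _).trans (max_le (h _ _) (h _ _))

variable (σ : PoissonEnd K n)

theorem totalDegree_apply_X_le (a : Fin n ⊕ Fin n) :
    (σ.toAlgHom (X a)).totalDegree ≤ σ.degree :=
  Finset.le_sup (f := fun a => (σ.toAlgHom (X a)).totalDegree) (Finset.mem_univ a)

theorem ofPoly_smul (q p : PoissonPoly K n) : WeylAlgebra.ofPoly K _ q • p = q * p := by
  induction q using MvPolynomial.induction_on generalizing p with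
  | C a => rw [← MvPolynomial.algebraMap_eq, AlgHom.commutes, algebraMap_smul, Algebra.smul_def]
  | add q r hq hr => rw [map_add, add_smul, hq, hr, add_mul]
  | mul_X q i hq => rw [map_mul, mul_smul, WeylAlgebra.ofPoly_X, WeylAlgebra.x_smul, hq, mul_assoc]

theorem totalDegree_weylEnd_x_smul_le (a : Fin n ⊕ Fin n) (p : PoissonPoly K n) :
    (σ.weylEnd (WeylAlgebra.x K a) • p).totalDegree ≤ σ.degree + p.totalDegree := by
  rw [weylEnd_x, ofPoly_smul]
  exact (totalDegree_mul _ _).trans (Nat.add_le_add_right (σ.totalDegree_apply_X_le a) _)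

/-- The degrees lost to differentiation are discarded: the `x` already raise degrees by up to
`σ.degree`, so a finer bound would not improve the filtration. -/
theorem totalDegree_weylEnd_d_smul_le (a : Fin n ⊕ Fin n) (p : PoissonPoly K n) :
    (σ.weylEnd (WeylAlgebra.d K a) • p).totalDegree ≤ σ.degree + p.totalDegree := by
  rw [weylEnd_d]
  rcases a with i | i
  · rw [Sum.elim_inl, hamiltonian_smul]
    exact (totalDegree_poissonBracket_le _ _).trans
      (Nat.add_le_add_right (σ.totalDegree_apply_X_le _) _)
  · rw [Sum.elim_inr, hamiltonian_smul]
    refine (totalDegree_poissonBracket_le _ _).trans ?_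
    rw [totalDegree_neg]
    exact Nat.add_le_add_right (σ.totalDegree_apply_X_le _) _

/-- The filtration of the twisted module by the total degree, rescaled by the degree of `σ`. -/
def degreeFiltration :
    WeylAlgebra.BernsteinFiltration K (Fin n ⊕ Fin n) σ.TwistedPoly where
  space k := restrictTotalDegree (Fin n ⊕ Fin n) K (σ.degree * k)
  mono s t hst p hp := (mem_restrictTotalDegree _ _ _).mpr
    (((mem_restrictTotalDegree _ _ _).mp hp).trans (Nat.mul_le_mul_left _ hst))
  x_smul_mem a k p hp := (mem_restrictTotalDegree _ _ _).mpr <|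
    (σ.totalDegree_weylEnd_x_smul_le a p).trans <| by
      rw [mul_add, mul_one, add_comm]
      exact Nat.add_le_add_right ((mem_restrictTotalDegree _ _ _).mp hp) _
  d_smul_mem a k p hp := (mem_restrictTotalDegree _ _ _).mpr <|
    (σ.totalDegree_weylEnd_d_smul_le a p).trans <| by
      rw [mul_add, mul_one, add_comm]
      exact Nat.add_le_add_right ((mem_restrictTotalDegree _ _ _).mp hp) _

/-- If all images of variables were constant, every bracket of them would vanish, but one conjugate
pair has bracket 1. -/
theorem degree_pos (hn : 0 < n) : 0 < σ.degree := by
  by_contra! h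
  have h0 (a b : Fin n ⊕ Fin n) : pderiv a (σ.toAlgHom (X b)) = 0 := by
    rw [totalDegree_eq_zero_iff_eq_C.mp
      (Nat.le_zero.mp ((σ.totalDegree_apply_X_le b).trans h)), pderiv_C]
  have h1 := bracket_map_momentum_X σ (Sum.inl ⟨0, hn⟩) (Sum.inl ⟨0, hn⟩)
  rw [pderiv_X_self, map_one] at h1
  refine one_ne_zero (α := PoissonPoly K n) (h1.symm.trans (Finset.sum_eq_zero fun i _ => ?_))
  rw [h0, h0, mul_zero, mul_zero, sub_zero]

theorem exists_mem_degreeFiltration (p : σ.TwistedPoly) :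
    ∃ k, p ∈ σ.degreeFiltration.space k := by
  refine ⟨(p : PoissonPoly K n).totalDegree, (mem_restrictTotalDegree _ _ _).mpr ?_⟩
  rcases Nat.eq_zero_or_pos n with rfl | hn
  · rw [totalDegree_eq_zero_iff_eq_C.mpr (eq_C_of_isEmpty (p : PoissonPoly K 0))]
    exact Nat.zero_le _
  · exact Nat.le_mul_of_pos_left _ (σ.degree_pos hn)

theorem finite_degreeFiltration (k : ℕ) : Module.Finite K (σ.degreeFiltration.space k) :=
  inferInstanceAs (Module.Finite K (restrictTotalDegree (Fin n ⊕ Fin n) K (σ.degree * k)))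

theorem finrank_degreeFiltration_le (k : ℕ) :
    Module.finrank K (σ.degreeFiltration.space k) ≤
      (σ.degree * k + Fintype.card (Fin n ⊕ Fin n)).choose (Fintype.card (Fin n ⊕ Fin n)) :=
  (finrank_restrictTotalDegree K (Fin n ⊕ Fin n) (σ.degree * k)).le

instance : Nontrivial σ.TwistedPoly := inferInstanceAs (Nontrivial (PoissonPoly K n))

end PoissonEnd

theorem mainTheorem3 (K : Type*) [Field K] [CharZero K] (n : ℕ) (σ : PoissonEnd K n) :
    WeylAlgebra.IsHolonomic K (Fin n ⊕ Fin n) σ.TwistedPoly ∧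
    IsFiniteLength (WeylAlgebra K (Fin n ⊕ Fin n)) σ.TwistedPoly ∧
    (∃ v : σ.TwistedPoly, Submodule.span (WeylAlgebra K (Fin n ⊕ Fin n)) {v} = ⊤) ∧
    Module.length (WeylAlgebra K (Fin n ⊕ Fin n)) σ.TwistedPoly ≤
      ((σ.degree ^ (2 * n) : ℕ) : ℕ∞) := by
  have hlen := σ.degreeFiltration.length_le σ.exists_mem_degreeFiltration
    σ.finite_degreeFiltration σ.finrank_degreeFiltration_le
  have hfin : IsFiniteLength (WeylAlgebra K (Fin n ⊕ Fin n)) σ.TwistedPoly :=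
    Module.length_ne_top_iff.mp (ne_top_of_le_ne_top (ENat.natCast_ne_top _) hlen)
  obtain ⟨_, _⟩ := isFiniteLength_iff_isNoetherian_isArtinian.mp hfin
  refine ⟨⟨inferInstance, le_antisymm ?_ WeylAlgebra.card_le_gkDim⟩, hfin, ?_, ?_⟩
  · exact σ.degreeFiltration.gkDim_le σ.exists_mem_degreeFiltration
      σ.finite_degreeFiltration σ.finrank_degreeFiltration_le
  -- For `n = 0` the torsion argument is unavailable, but the module is just `K`, generated by 1.
  · rcases Nat.eq_zero_or_pos n with rfl | hn
    · let v : σ.TwistedPoly := (1 : PoissonPoly K 0)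
      refine ⟨v, Submodule.eq_top_iff'.mpr fun p => Submodule.mem_span_singleton.mpr ?_⟩
      let c : K := coeff 0 (show PoissonPoly K 0 from p)
      exact ⟨algebraMap K _ c, (algebraMap_smul _ c v).trans
        (((smul_eq_C_mul (1 : PoissonPoly K 0) c).trans (mul_one _)).trans
          (eq_C_of_isEmpty (show PoissonPoly K 0 from p)).symm)⟩
    · have : Nonempty (Fin n ⊕ Fin n) := ⟨Sum.inl ⟨0, hn⟩⟩
      exact WeylAlgebra.exists_span_singleton_eq_top fun u =>
        σ.degreeFiltration.exists_ne_zero_orbitMap_eq_zero σ.exists_mem_degreeFiltration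
          σ.finite_degreeFiltration σ.finrank_degreeFiltration_le u
  · rwa [Fintype.card_sum, Fintype.card_fin, ← two_mul] at hlen

end
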